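/- **Setting.** Let $\mathbb F$ be an algebraically closed field, let $d\ge 3$ be an integer, and let $V$ be a vector space over $\mathbb F$ of dimension $d+1$. A square matrix is *irreducible tridiagonal* if it is tridiagonal and all its entries on the superdiagonal and on the subdiagonal are nonzero. A *Leonard pair* on $V$ is an ordered pair $A,A^*$ of linear maps $V\to V$ such that some basis of $V$ makes $A$ irreducible tridiagonal and $A^*$ diagonal, and some basis of $V$ makes $A^*$ irreducible tridiagonal and $A$ diagonal. (Then each of $A,A^*$ has $d+1$ distinct eigenvalues.) An ordering $\theta_0,\dots,\theta_d$ of the eigenvalues of $A$ is *standard* if corresponding eigenvectors $v_0,\dots,v_d$ form a basis that makes $A^*$ irreducible tridiagonal; the corresponding ordering $E_0,\dots,E_d$ of the primitive idempotents of $A$ ($E_i$ is the projection onto the $\theta_i$-eigenspace along the sum of the other eigenspaces) is then also called standard. Standard orderings for $A^*$ are defined in the same way, with $A$ and $A^*$ interchanged. A *Leonard system* is a sequence $\Phi=(A;\{E_i\}_{i=0}^d;A^*;\{E_i^*\}_{i=0}^d)$ in which $A,A^*$ is a Leonard pair and $\{E_i\}$, $\{E^*_i\}$ are standard orderings of the primitive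 idempotents of $A$, $A^*$. Fix a Leonard system $\Phi$ on $V$. Let $\theta_i$ (resp. $\theta^*_i$) be the eigenvalue of $A$ (resp. $A^*$) associated with $E_i$ (resp. $E^*_i$), and let $a_i=\operatorname{tr}(E^*_iA)$ for $0\le i\le d$. For $0\ne u\in E_0^*V$ the vectors $u_i=(A-\theta_0 I)\cdots(A-\theta_{i-1}I)u$ $(0\le i\le d)$ form a basis of $V$ in which $A^*$ is upper bidiagonal with diagonal entries $\theta^*_0,\dots,\theta^*_d$ and superdiagonal entries $\varphi_1,\dots,\varphi_d$, not depending on $u$ ($\varphi_i$ is the coefficient of $u_{i-1}$ in $A^*u_i$); $\{\varphi_i\}_{i=1}^d$ is the *first split sequence* of $\Phi$. The *second split sequence* $\{\phi_i\}_{i=1}^d$ of $\Phi$ is the first split sequence of $(A;\{E_{d-i}\}_{i=0}^d;A^*;\{E^*_i\}_{i=0}^d)$. **Types.** Below, equations for $\theta_i,\theta^*_i$ hold for $0\le i\le d$, and those for $\varphi_i,\phi_i$ hold for $1\le i\le d$; all parameters are in $\mathbb F$. Write $g_i=(1-q^i)(1-q^{i-d-1})$. The condition (C) is: $\operatorname{char}\mathbb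 F$ is $0$ or a prime greater than $d$. We say that $\Phi$ has the given type with the given parameters if the listed conditions hold. 1. *$q$-Racah* ($q,h,h^*,s,s^*,r_1,r_2$, all nonzero): $r_1r_2=ss^*q^{d+1}$; none of $q^i,r_1q^i,r_2q^i,s^*q^i/r_1,s^*q^i/r_2$ equals $1$ for $1\le i\le d$; $sq^i\ne1$, $s^*q^i\neq 1$ for $2\le i\le 2d$; $\theta_i=\theta_0+h(1-q^i)(1-sq^{i+1})q^{-i}$; $\theta^*_i=\theta^*_0+h^*(1-q^i)(1-s^*q^{i+1})q^{-i}$; $\varphi_i=hh^*q^{1-2i}g_i(1-r_1q^i)(1-r_2q^i)$; $\phi_i=hh^*q^{1-2i}g_i(r_1-s^*q^i)(r_2-s^*q^i)/s^*$. 2. *$q$-Hahn* ($q,h,h^*,s^*,r$, all nonzero): none of $q^i,rq^i,s^*q^i/r$ equals $1$ for $1\le i\le d$; $s^*q^i\ne1$ for $2\le i\le2d$; $\theta_i=\theta_0+h(1-q^i)q^{-i}$; $\theta^*_i=\theta_0^*+h^*(1-q^i)(1-s^*q^{i+1})q^{-i}$; $\varphi_i=hh^*q^{1-2i}g_i(1-rq^i)$;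 $\phi_i=-hh^*q^{1-i}g_i(r-s^*q^i)$. 3. *dual $q$-Hahn* ($q,h,h^*,s,r$, all nonzero): none of $q^i,rq^i,sq^i/r$ equals $1$ for $1\le i\le d$; $sq^i\ne1$ for $2\le i\le2d$; $\theta_i=\theta_0+h(1-q^i)(1-sq^{i+1})q^{-i}$; $\theta^*_i=\theta^*_0+h^*(1-q^i)q^{-i}$; $\varphi_i=hh^*q^{1-2i}g_i(1-rq^i)$; $\phi_i=hh^*q^{d+2-2i}g_i(s-rq^{i-d-1})$. 4. *quantum $q$-Krawtchouk* ($q,h^*,s,r$, all nonzero): $q^i\ne1$, $sq^i/r\ne1$ for $1\le i\le d$; $\theta_i=\theta_0-sq(1-q^i)$; $\theta^*_i=\theta_0^*+h^*(1-q^i)q^{-i}$; $\varphi_i=-rh^*q^{1-i}g_i$; $\phi_i=h^*q^{d+2-2i}g_i(s-rq^{i-d-1})$. 5. *$q$-Krawtchouk* ($q,h,h^*,s^*$, all nonzero): $q^i\ne1$ for $1\le i\le d$; $s^*q^i\ne1$ for $2\le i\le2d$; $\theta_i=\theta_0+h(1-q^i)q^{-i}$; $\theta^*_i=\theta^*_0+h^*(1-q^i)(1-s^*q^{i+1})q^{-i}$;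 $\varphi_i=hh^*q^{1-2i}g_i$; $\phi_i=hh^*s^*qg_i$. 6. *affine $q$-Krawtchouk* ($q,h,h^*,r$, all nonzero): $q^i\ne1$, $rq^i\ne1$ for $1\le i\le d$; $\theta_i=\theta_0+h(1-q^i)q^{-i}$; $\theta_i^*=\theta_0^*+h^*(1-q^i)q^{-i}$; $\varphi_i=hh^*q^{1-2i}g_i(1-rq^i)$; $\phi_i=-hh^*rq^{1-i}g_i$. 7. *dual $q$-Krawtchouk* ($q,h,h^*,s$, all nonzero): $q^i\ne1$ for $1\le i\le d$; $sq^i\ne1$ for $2\le i\le2d$; $\theta_i=\theta_0+h(1-q^i)(1-sq^{i+1})q^{-i}$; $\theta^*_i=\theta^*_0+h^*(1-q^i)q^{-i}$; $\varphi_i=hh^*q^{1-2i}g_i$; $\phi_i=hh^*sq^{d+2-2i}g_i$. 8. *Racah* ($h,h^*,s,s^*,r_1,r_2$ with $h,h^*\ne0$): (C); $r_1+r_2=s+s^*+d+1$; none of $r_1,r_2,s^*-r_1,s^*-r_2$ equals $-i$ for $1\le i\le d$; $s\ne-i$, $s^*\ne-i$ for $2\le i\le2d$; $\theta_i=\theta_0+hi(i+1+s)$;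 $\theta^*_i=\theta^*_0+h^*i(i+1+s^*)$; $\varphi_i=hh^*i(i-d-1)(i+r_1)(i+r_2)$; $\phi_i=hh^*i(i-d-1)(i+s^*-r_1)(i+s^*-r_2)$. 9. *Hahn* ($h^*,s,s^*,r$ with $h^*,s\ne0$): (C); neither of $r,s^*-r$ equals $-i$ for $1\le i\le d$; $s^*\ne-i$ for $2\le i\le2d$; $\theta_i=\theta_0+si$; $\theta_i^*=\theta_0^*+h^*i(i+1+s^*)$; $\varphi_i=h^*si(i-d-1)(i+r)$; $\phi_i=-h^*si(i-d-1)(i+s^*-r)$. 10. *dual Hahn* ($h,s,s^*,r$ with $h,s^*\ne0$): (C); neither of $r,s-r$ equals $-i$ for $1\le i\le d$; $s\ne-i$ for $2\le i\le2d$; $\theta_i=\theta_0+hi(i+1+s)$; $\theta^*_i=\theta^*_0+s^*i$; $\varphi_i=hs^*i(i-d-1)(i+r)$; $\phi_i=hs^*i(i-d-1)(i+r-s-d-1)$. 11. *Krawtchouk* ($s,s^*,r$, all nonzero): (C); $r\ne ss^*$; $\theta_i=\theta_0+si$; $\theta^*_i=\theta_0^*+s^*i$; $\varphi_i=ri(i-d-1)$;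 $\phi_i=(r-ss^*)i(i-d-1)$. 12. *Bannai/Ito* ($h,h^*,s,s^*,r_1,r_2$ with $h,h^*\ne0$): $\operatorname{char}\mathbb F$ is $0$ or an odd prime greater than $d/2$; $r_1+r_2=-s-s^*+d+1$; neither of $r_1,-s^*-r_1$ equals $-i$ for $1\le i\le d$ with $d-i$ even; neither of $r_2,-s^*-r_2$ equals $-i$ for $1\le i\le d$ with $i$ odd; neither of $s,s^*$ equals $2i$ for $1\le i\le d$; $\theta_i=\theta_0+h\big(s-1+(1-s+2i)(-1)^i\big)$; $\theta^*_i=\theta^*_0+h^*\big(s^*-1+(1-s^*+2i)(-1)^i\big)$; if $d$ is even, then $\varphi_i=-4hh^*i(i+r_1)$ and $\phi_i=4hh^*i(i-s^*-r_1)$ for $i$ even, $\varphi_i=-4hh^*(i-d-1)(i+r_2)$ and $\phi_i=4hh^*(i-d-1)(i-s^*-r_2)$ for $i$ odd; if $d$ is odd, then $\varphi_i=\phi_i=-4hh^*i(i-d-1)$ for $i$ even, $\varphi_i=-4hh^*(i+r_1)(i+r_2)$ and $\phi_i=-4hh^*(i-s^*-r_1)(i-s^*-r_2)$ for $i$ odd.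 13. *Orphan* ($h,h^*,s,s^*,r$, all nonzero): $d=3$; $\operatorname{char}\mathbb F=2$; $s\ne1$, $s^*\ne1$; $r$ is none of $s+s^*$, $s(1+s^*)$, $s^*(1+s)$; $\theta_1=\theta_0+h(s+1)$, $\theta_2=\theta_0+h$, $\theta_3=\theta_0+hs$; $\theta_1^*=\theta_0^*+h^*(s^*+1)$, $\theta_2^*=\theta^*_0+h^*$, $\theta^*_3=\theta^*_0+h^*s^*$; $\varphi_1=hh^*r$, $\varphi_2=hh^*$, $\varphi_3=hh^*(r+s+s^*)$; $\phi_1=hh^*(r+s+ss^*)$, $\phi_2=hh^*$, $\phi_3=hh^*(r+s^*+ss^*)$. **Proposition 8.1.** Let $1\le i,j\le d-1$. If $\Phi$ has one of the thirteen types, with parameters as above, then $$(a_i-a_0)(\theta^*_i-\theta^*_d)(a_j-a_d)(\theta^*_j-\theta^*_0)-(a_i-a_d)(\theta^*_i-\theta^*_0)(a_j-a_0)(\theta^*_j-\theta^*_d)$$ is equal to $$\frac{(\theta^*_0-\theta^*_i)(\theta^*_0-\theta^*_j)(\theta^*_0-\theta^*_d)(\theta^*_i-\theta^*_j)(\theta^*_i-\theta^*_d)(\theta^*_j-\theta^*_d)}{(\theta^*_0-\theta^*_1)(\theta^*_{i-1}-\theta^*_i)(\theta^*_i-\theta^*_{i+1})(\theta^*_{j-1}-\theta^*_j)(\theta^*_j-\theta^*_{j+1})(\theta^*_{d-1}-\theta^*_d)}$$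 times the following factor: - $q$-Racah: $h^2h^{*2}q^{-3-d}(q-1)^4(q^2-1)^2(s^*-r_1^2)(s^*-r_2^2)/s^*$; - $q$-Hahn: $h^2h^{*2}q^{-3-d}(q-1)^4(q^2-1)^2(s^*-r^2)$; - dual $q$-Hahn: $-h^2h^{*2}q^{-3-d}(q-1)^4(q^2-1)^2r^2$; - quantum $q$-Krawtchouk: $-h^{*2}q^{-3-d}(q-1)^4(q^2-1)^2r^2$; - $q$-Krawtchouk: $h^2h^{*2}q^{-3-d}(q-1)^4(q^2-1)^2s^*$; - affine $q$-Krawtchouk: $-h^2h^{*2}q^{-3-d}(q-1)^4(q^2-1)^2r^2$; - dual $q$-Krawtchouk: $0$; - Racah: $4h^2h^{*2}(s^*-2r_1)(s^*-2r_2)$; - Hahn: $0$; - dual Hahn: $-4h^2s^{*2}$; - Krawtchouk: $0$; - Bannai/Ito: $64(-1)^{d+1}h^2h^{*2}(s^*+2r_1)(s^*+2r_2)$; - Orphan: $h^2h^{*2}(s^{*2}+1)$. -/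

import Mathlib

universe u v

/-- A square matrix is irreducible tridiagonal: all entries off the three central diagonals vanish,
and all entries on the subdiagonal and on the superdiagonal are nonzero. -/
def IsIrreducibleTridiagonal {F : Type u} [Field F] {n : ℕ} (M : Matrix (Fin n) (Fin n) F) : Prop :=
  ∀ i j : Fin n,
    (((i : ℕ) + 1 < (j : ℕ) ∨ (j : ℕ) + 1 < (i : ℕ)) → M i j = 0) ∧
    (((i : ℕ) + 1 = (j : ℕ) ∨ (j : ℕ) + 1 = (i : ℕ)) → M i j ≠ 0)

/-- `A, Astar` is a Leonard pair on `V`. -/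
structure IsLeonardPair {F : Type u} {V : Type v} [Field F] [AddCommGroup V] [Module F V]
    (A Astar : Module.End F V) : Prop where
  exists_basis : ∃ (n : ℕ) (b : Module.Basis (Fin n) F V),
    IsIrreducibleTridiagonal (LinearMap.toMatrix b b A) ∧ (LinearMap.toMatrix b b Astar).IsDiag
  exists_basis_star : ∃ (n : ℕ) (b : Module.Basis (Fin n) F V),
    IsIrreducibleTridiagonal (LinearMap.toMatrix b b Astar) ∧ (LinearMap.toMatrix b b A).IsDiag

/-- For a Leonard pair `A, Astar`: `θ` is a standard ordering of the eigenvalues of `A`, that is,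
`θ` lists all eigenvalues of `A` without repetition, and eigenvectors `v 0, …, v d` of `A` for
`θ 0, …, θ d` form a basis with respect to which `Astar` is irreducible tridiagonal. -/
structure IsStandardEigenvalueOrdering {F : Type u} {V : Type v} [Field F] [AddCommGroup V]
    [Module F V] {d : ℕ} (A Astar : Module.End F V) (θ : Fin (d + 1) → F) : Prop where
  injective : Function.Injective θ
  hasEigenvalue_iff : ∀ μ : F, A.HasEigenvalue μ ↔ ∃ i, θ i = μ
  exists_eigenbasis : ∃ v : Module.Basis (Fin (d + 1)) F V,
    (∀ i, A (v i) = θ i • v i) ∧ IsIrreducibleTridiagonal (LinearMap.toMatrix v v Astar)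

/-- `E i` is the primitive idempotent of `A` associated with the eigenvalue `θ i`: it is the
identity on the `θ i`-eigenspace and zero on the `θ j`-eigenspace for `j ≠ i`. -/
def ArePrimitiveIdempotents {F : Type u} {V : Type v} [Field F] [AddCommGroup V]
    [Module F V] {d : ℕ} (A : Module.End F V) (θ : Fin (d + 1) → F)
    (E : Fin (d + 1) → Module.End F V) : Prop :=
  ∀ i j : Fin (d + 1), ∀ x ∈ A.eigenspace (θ j), E i x = if j = i then x else 0

/-- `E` is a standard ordering of the primitive idempotents of `A`. -/
def IsStandardIdempotentOrdering {F : Type u} {V : Type v} [Field F] [AddCommGroup V]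
    [Module F V] {d : ℕ} (A Astar : Module.End F V) (E : Fin (d + 1) → Module.End F V) : Prop :=
  ∃ θ : Fin (d + 1) → F,
    IsStandardEigenvalueOrdering A Astar θ ∧ ArePrimitiveIdempotents A θ E

/-- A Leonard system `(A; E_0, …, E_d; A*; E*_0, …, E*_d)` on `V`. -/
structure LeonardSystem (F : Type u) (V : Type v) [Field F] [AddCommGroup V] [Module F V]
    (d : ℕ) where
  A : Module.End F V
  E : Fin (d + 1) → Module.End F V
  Astar : Module.End F V
  Estar : Fin (d + 1) → Module.End F V
  isLeonardPair : IsLeonardPair A Astar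
  standard : IsStandardIdempotentOrdering A Astar E
  standard_star : IsStandardIdempotentOrdering Astar A Estar

namespace LeonardSystem

variable {F : Type u} {V : Type v} [Field F] [AddCommGroup V] [Module F V] {d : ℕ}

/-- The eigenvalue `θ_i` of `A` associated with `E_i`, for `0 ≤ i ≤ d` (and `0` for `i > d`). -/
noncomputable def th (Φ : LeonardSystem F V d) (i : ℕ) : F :=
  if h : i < d + 1 then Classical.choose Φ.standard ⟨i, h⟩ else 0

/-- The eigenvalue `θ*_i` of `A*` associated with `E*_i`, for `0 ≤ i ≤ d` (and `0` for `i > d`). -/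
noncomputable def thstar (Φ : LeonardSystem F V d) (i : ℕ) : F :=
  if h : i < d + 1 then Classical.choose Φ.standard_star ⟨i, h⟩ else 0

/-- The scalar `a_i = tr (E*_i A)`, for `0 ≤ i ≤ d` (and `0` for `i > d`). -/
noncomputable def a (Φ : LeonardSystem F V d) (i : ℕ) : F :=
  if h : i < d + 1 then LinearMap.trace F V (Φ.Estar ⟨i, h⟩ * Φ.A) else 0

/-- The vector `τ_i(A) w`, where `τ_i(x) = (x - θ_0)(x - θ_1) ⋯ (x - θ_{i-1})`. -/
noncomputable def splitVector (Φ : LeonardSystem F V d) (w : V) (i : Fin (d + 1)) : V :=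
  Polynomial.aeval Φ.A
    (∏ k ∈ Finset.range (i : ℕ), (Polynomial.X - Polynomial.C (Φ.th k))) w

theorem exists_mem_range_Estar_zero (Φ : LeonardSystem F V d) :
    ∃ w : V, w ∈ LinearMap.range (Φ.Estar 0) ∧ w ≠ 0 := by
  obtain ⟨θ, hθ, hE⟩ := Φ.standard_star
  obtain ⟨v, hv, -⟩ := hθ.exists_eigenbasis
  refine ⟨v 0, ⟨v 0, ?_⟩, v.ne_zero 0⟩
  rw [hE 0 0 (v 0) (Module.End.mem_eigenspace_iff.2 (hv 0))]
  simp

theorem isUnit_det_splitVector (Φ : LeonardSystem F V d) {w : V}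
    (hw : w ∈ LinearMap.range (Φ.Estar 0)) (hw0 : w ≠ 0) :
    ∃ v : Module.Basis (Fin (d + 1)) F V, IsUnit (v.det (Φ.splitVector w)) := by
  obtain ⟨θ, hθ, hE⟩ := Φ.standard_star
  obtain ⟨v, hv, hM⟩ := hθ.exists_eigenbasis
  refine ⟨v, ?_⟩
  -- `w` is a multiple of `v 0`
  have hw1 : ∀ j : Fin (d + 1), j ≠ 0 → v.repr w j = 0 := by
    obtain ⟨x, rfl⟩ := hw
    intro j hj
    rw [← v.sum_repr x, map_sum, map_sum, Finsupp.finsetSum_apply]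
    refine Finset.sum_eq_zero fun k _ => ?_
    rw [map_smul, hE 0 k (v k) (Module.End.mem_eigenspace_iff.2 (hv k))]
    by_cases hk : k = 0
    · subst hk
      simp [Ne.symm hj]
    · simp [hk]
  have hw2 : v.repr w 0 ≠ 0 := by
    intro h
    apply hw0
    apply v.repr.injective
    ext j
    by_cases hj : j = 0
    · subst hj; simpa using h
    · simpa using hw1 j hj
  have hA : ∀ (x : V) (j : Fin (d + 1)), v.repr (Φ.A x) j
      = ∑ k, LinearMap.toMatrix v v Φ.A j k * v.repr x k := by
    intro x j
    have := congrFun (LinearMap.toMatrix_mulVec_repr v v Φ.A x) j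
    rw [← this]; rfl
  have key : ∀ n : ℕ, ∀ hn : n < d + 1,
      (∀ j : Fin (d + 1), n < (j : ℕ) → v.repr (Φ.splitVector w ⟨n, hn⟩) j = 0) ∧
      v.repr (Φ.splitVector w ⟨n, hn⟩) ⟨n, hn⟩ ≠ 0 := by
    intro n
    induction n with
    | zero =>
      intro hn
      have h0 : Φ.splitVector w ⟨0, hn⟩ = w := by simp [splitVector]
      rw [h0]
      refine ⟨fun j hj => hw1 j ?_, hw2⟩
      rintro rfl
      simp at hj
    | succ n ih =>
      intro hn
      have hn' : n < d + 1 := by omega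
      obtain ⟨ih1, ih2⟩ := ih hn'
      have hs : Φ.splitVector w ⟨n + 1, hn⟩
          = Φ.A (Φ.splitVector w ⟨n, hn'⟩) - Φ.th n • Φ.splitVector w ⟨n, hn'⟩ := by
        simp only [splitVector]
        rw [Finset.prod_range_succ, mul_comm, map_mul]
        simp [Module.algebraMap_end_apply]
      have hz : ∀ j : Fin (d + 1), n < (j : ℕ) →
          v.repr (Φ.splitVector w ⟨n + 1, hn⟩) j =
          LinearMap.toMatrix v v Φ.A j ⟨n, hn'⟩ * v.repr (Φ.splitVector w ⟨n, hn'⟩) ⟨n, hn'⟩ := by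
        intro j hj
        rw [hs, map_sub, map_smul, Finsupp.sub_apply, Finsupp.smul_apply, ih1 j hj, smul_zero,
          sub_zero, hA, Finset.sum_eq_single ⟨n, hn'⟩]
        · intro k _ hk
          rcases lt_trichotomy (k : ℕ) n with h | h | h
          · rw [((hM j k).1 (Or.inr (by omega))), zero_mul]
          · exact absurd (Fin.ext h) hk
          · rw [ih1 k h, mul_zero]
        · simp
      refine ⟨fun j hj => ?_, ?_⟩
      · rw [hz j (by omega), (hM j ⟨n, hn'⟩).1 (Or.inr hj), zero_mul]
      · rw [hz _ (by simp)]
        exact mul_ne_zero ((hM _ _).2 (Or.inr rfl)) ih2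
  have htri : Matrix.BlockTriangular (v.toMatrix (Φ.splitVector w)) id := by
    intro i j hij
    exact (key j j.2).1 i hij
  rw [Module.Basis.det_apply, Matrix.det_of_isUpperTriangular htri, isUnit_iff_ne_zero,
    Finset.prod_ne_zero_iff]
  intro i _
  exact (key i i.2).2

/-- The `Φ`-split basis `τ_0(A) w, …, τ_d(A) w` attached to a nonzero vector `w` of `E*_0 V`. -/
noncomputable def splitBasis (Φ : LeonardSystem F V d) (w : V)
    (hw : w ∈ LinearMap.range (Φ.Estar 0)) (hw0 : w ≠ 0) : Module.Basis (Fin (d + 1)) F V :=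
  have h : LinearIndependent F (Φ.splitVector w) ∧
      Submodule.span F (Set.range (Φ.splitVector w)) = ⊤ :=
    (Φ.isUnit_det_splitVector hw hw0).elim fun e he => (Module.Basis.is_basis_iff_det e).2 he
  Module.Basis.mk h.1 h.2.ge

/-- The first split sequence `φ_1, …, φ_d` (printed `\varphi_i`): with respect to a `Φ`-split basis,
`φ_i` is the entry in row `i - 1` and column `i` (rows and columns numbered from `0`) of the matrix
that represents `A*`. (It does not depend on the vector `w`, which is unique up to a nonzero scalar;
the value is `0` for `i` outside `1, …, d`.) -/
noncomputable def firstSplit (Φ : LeonardSystem F V d) (i : ℕ) : F :=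
  if h : 1 ≤ i ∧ i ≤ d then
    let w := Classical.choose Φ.exists_mem_range_Estar_zero
    let hw := Classical.choose_spec Φ.exists_mem_range_Estar_zero
    LinearMap.toMatrix (Φ.splitBasis w hw.1 hw.2) (Φ.splitBasis w hw.1 hw.2) Φ.Astar
      ⟨i - 1, by omega⟩ ⟨i, by omega⟩
  else 0

/-- The Leonard system `(A; E_d, …, E_0; A*; E*_0, …, E*_d)`. -/
def revE (Φ : LeonardSystem F V d) : LeonardSystem F V d where
  A := Φ.A
  E := fun i => Φ.E i.rev
  Astar := Φ.Astar
  Estar := Φ.Estar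
  isLeonardPair := Φ.isLeonardPair
  standard := by
    obtain ⟨θ, hθ, hE⟩ := Φ.standard
    refine ⟨fun i => θ i.rev, ⟨hθ.injective.comp Fin.rev_injective, ?_, ?_⟩, ?_⟩
    · intro μ
      rw [hθ.hasEigenvalue_iff]
      exact ⟨fun ⟨i, hi⟩ => ⟨i.rev, by simpa using hi⟩, fun ⟨i, hi⟩ => ⟨i.rev, hi⟩⟩
    · obtain ⟨v, hv, hM⟩ := hθ.exists_eigenbasis
      refine ⟨v.reindex Fin.revPerm, fun i => by simpa using hv i.rev, fun i j => ?_⟩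
      have h := hM i.rev j.rev
      have e : LinearMap.toMatrix (v.reindex Fin.revPerm) (v.reindex Fin.revPerm) Φ.Astar i j
          = LinearMap.toMatrix v v Φ.Astar i.rev j.rev := by
        simp [LinearMap.toMatrix_apply]
      rw [e]
      have hi := i.2
      have hj := j.2
      refine ⟨fun hh => h.1 ?_, fun hh => h.2 ?_⟩ <;> simp only [Fin.val_rev] <;> omega
    · intro i j x hx
      rw [hE i.rev j.rev x hx]
      simp
  standard_star := Φ.standard_star

/-- The second split sequence `ϕ_1, …, ϕ_d` (printed `\phi_i`) of `Φ`. -/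
noncomputable def secondSplit (Φ : LeonardSystem F V d) (i : ℕ) : F := Φ.revE.firstSplit i

/-! The thirteen types, with their parameters. -/

/-- `q`-Racah type. -/
structure IsQRacah (Φ : LeonardSystem F V d) (q h hstar s sstar r₁ r₂ : F) : Prop where
  ne_zero : q ≠ 0 ∧ h ≠ 0 ∧ hstar ≠ 0 ∧ s ≠ 0 ∧ sstar ≠ 0 ∧ r₁ ≠ 0 ∧ r₂ ≠ 0
  r_mul : r₁ * r₂ = s * sstar * q ^ (d + 1)
  ne_one : ∀ i : ℕ, 1 ≤ i → i ≤ d → q ^ i ≠ 1 ∧ r₁ * q ^ i ≠ 1 ∧ r₂ * q ^ i ≠ 1 ∧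
    sstar * q ^ i / r₁ ≠ 1 ∧ sstar * q ^ i / r₂ ≠ 1
  s_ne : ∀ i : ℕ, 2 ≤ i → i ≤ 2 * d → s * q ^ i ≠ 1 ∧ sstar * q ^ i ≠ 1
  th_eq : ∀ i : ℕ, i ≤ d →
    Φ.th i = Φ.th 0 + h * (1 - q ^ i) * (1 - s * q ^ (i + 1)) * q ^ (-(i : ℤ))
  thstar_eq : ∀ i : ℕ, i ≤ d → Φ.thstar i =
    Φ.thstar 0 + hstar * (1 - q ^ i) * (1 - sstar * q ^ (i + 1)) * q ^ (-(i : ℤ))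
  firstSplit_eq : ∀ i : ℕ, 1 ≤ i → i ≤ d → Φ.firstSplit i =
    h * hstar * q ^ (1 - 2 * (i : ℤ)) * (1 - q ^ i) * (1 - q ^ ((i : ℤ) - d - 1)) *
      (1 - r₁ * q ^ i) * (1 - r₂ * q ^ i)
  secondSplit_eq : ∀ i : ℕ, 1 ≤ i → i ≤ d → Φ.secondSplit i =
    h * hstar * q ^ (1 - 2 * (i : ℤ)) * (1 - q ^ i) * (1 - q ^ ((i : ℤ) - d - 1)) *
      (r₁ - sstar * q ^ i) * (r₂ - sstar * q ^ i) / sstar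

/-- `q`-Hahn type. -/
structure IsQHahn (Φ : LeonardSystem F V d) (q h hstar sstar r : F) : Prop where
  ne_zero : q ≠ 0 ∧ h ≠ 0 ∧ hstar ≠ 0 ∧ sstar ≠ 0 ∧ r ≠ 0
  ne_one : ∀ i : ℕ, 1 ≤ i → i ≤ d → q ^ i ≠ 1 ∧ r * q ^ i ≠ 1 ∧ sstar * q ^ i / r ≠ 1
  s_ne : ∀ i : ℕ, 2 ≤ i → i ≤ 2 * d → sstar * q ^ i ≠ 1
  th_eq : ∀ i : ℕ, i ≤ d → Φ.th i = Φ.th 0 + h * (1 - q ^ i) * q ^ (-(i : ℤ))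
  thstar_eq : ∀ i : ℕ, i ≤ d → Φ.thstar i =
    Φ.thstar 0 + hstar * (1 - q ^ i) * (1 - sstar * q ^ (i + 1)) * q ^ (-(i : ℤ))
  firstSplit_eq : ∀ i : ℕ, 1 ≤ i → i ≤ d → Φ.firstSplit i =
    h * hstar * q ^ (1 - 2 * (i : ℤ)) * (1 - q ^ i) * (1 - q ^ ((i : ℤ) - d - 1)) *
      (1 - r * q ^ i)
  secondSplit_eq : ∀ i : ℕ, 1 ≤ i → i ≤ d → Φ.secondSplit i =
    -(h * hstar * q ^ (1 - (i : ℤ)) * (1 - q ^ i) * (1 - q ^ ((i : ℤ) - d - 1)) *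
      (r - sstar * q ^ i))

/-- Dual `q`-Hahn type. -/
structure IsDualQHahn (Φ : LeonardSystem F V d) (q h hstar s r : F) : Prop where
  ne_zero : q ≠ 0 ∧ h ≠ 0 ∧ hstar ≠ 0 ∧ s ≠ 0 ∧ r ≠ 0
  ne_one : ∀ i : ℕ, 1 ≤ i → i ≤ d → q ^ i ≠ 1 ∧ r * q ^ i ≠ 1 ∧ s * q ^ i / r ≠ 1
  s_ne : ∀ i : ℕ, 2 ≤ i → i ≤ 2 * d → s * q ^ i ≠ 1
  th_eq : ∀ i : ℕ, i ≤ d →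
    Φ.th i = Φ.th 0 + h * (1 - q ^ i) * (1 - s * q ^ (i + 1)) * q ^ (-(i : ℤ))
  thstar_eq : ∀ i : ℕ, i ≤ d → Φ.thstar i =
    Φ.thstar 0 + hstar * (1 - q ^ i) * q ^ (-(i : ℤ))
  firstSplit_eq : ∀ i : ℕ, 1 ≤ i → i ≤ d → Φ.firstSplit i =
    h * hstar * q ^ (1 - 2 * (i : ℤ)) * (1 - q ^ i) * (1 - q ^ ((i : ℤ) - d - 1)) *
      (1 - r * q ^ i)
  secondSplit_eq : ∀ i : ℕ, 1 ≤ i → i ≤ d → Φ.secondSplit i =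
    h * hstar * q ^ ((d : ℤ) + 2 - 2 * (i : ℤ)) * (1 - q ^ i) * (1 - q ^ ((i : ℤ) - d - 1)) *
      (s - r * q ^ ((i : ℤ) - d - 1))

/-- Quantum `q`-Krawtchouk type. -/
structure IsQuantumQKrawtchouk (Φ : LeonardSystem F V d) (q hstar s r : F) : Prop where
  ne_zero : q ≠ 0 ∧ hstar ≠ 0 ∧ s ≠ 0 ∧ r ≠ 0
  ne_one : ∀ i : ℕ, 1 ≤ i → i ≤ d → q ^ i ≠ 1 ∧ s * q ^ i / r ≠ 1
  th_eq : ∀ i : ℕ, i ≤ d → Φ.th i = Φ.th 0 - s * q * (1 - q ^ i)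
  thstar_eq : ∀ i : ℕ, i ≤ d → Φ.thstar i =
    Φ.thstar 0 + hstar * (1 - q ^ i) * q ^ (-(i : ℤ))
  firstSplit_eq : ∀ i : ℕ, 1 ≤ i → i ≤ d → Φ.firstSplit i =
    -(r * hstar * q ^ (1 - (i : ℤ)) * (1 - q ^ i) * (1 - q ^ ((i : ℤ) - d - 1)))
  secondSplit_eq : ∀ i : ℕ, 1 ≤ i → i ≤ d → Φ.secondSplit i =
    hstar * q ^ ((d : ℤ) + 2 - 2 * (i : ℤ)) * (1 - q ^ i) * (1 - q ^ ((i : ℤ) - d - 1)) *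
      (s - r * q ^ ((i : ℤ) - d - 1))

/-- `q`-Krawtchouk type. -/
structure IsQKrawtchouk (Φ : LeonardSystem F V d) (q h hstar sstar : F) : Prop where
  ne_zero : q ≠ 0 ∧ h ≠ 0 ∧ hstar ≠ 0 ∧ sstar ≠ 0
  ne_one : ∀ i : ℕ, 1 ≤ i → i ≤ d → q ^ i ≠ 1
  s_ne : ∀ i : ℕ, 2 ≤ i → i ≤ 2 * d → sstar * q ^ i ≠ 1
  th_eq : ∀ i : ℕ, i ≤ d → Φ.th i = Φ.th 0 + h * (1 - q ^ i) * q ^ (-(i : ℤ))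
  thstar_eq : ∀ i : ℕ, i ≤ d → Φ.thstar i =
    Φ.thstar 0 + hstar * (1 - q ^ i) * (1 - sstar * q ^ (i + 1)) * q ^ (-(i : ℤ))
  firstSplit_eq : ∀ i : ℕ, 1 ≤ i → i ≤ d → Φ.firstSplit i =
    h * hstar * q ^ (1 - 2 * (i : ℤ)) * (1 - q ^ i) * (1 - q ^ ((i : ℤ) - d - 1))
  secondSplit_eq : ∀ i : ℕ, 1 ≤ i → i ≤ d → Φ.secondSplit i =
    h * hstar * sstar * q * (1 - q ^ i) * (1 - q ^ ((i : ℤ) - d - 1))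

/-- Affine `q`-Krawtchouk type. -/
structure IsAffineQKrawtchouk (Φ : LeonardSystem F V d) (q h hstar r : F) : Prop where
  ne_zero : q ≠ 0 ∧ h ≠ 0 ∧ hstar ≠ 0 ∧ r ≠ 0
  ne_one : ∀ i : ℕ, 1 ≤ i → i ≤ d → q ^ i ≠ 1 ∧ r * q ^ i ≠ 1
  th_eq : ∀ i : ℕ, i ≤ d → Φ.th i = Φ.th 0 + h * (1 - q ^ i) * q ^ (-(i : ℤ))
  thstar_eq : ∀ i : ℕ, i ≤ d → Φ.thstar i =
    Φ.thstar 0 + hstar * (1 - q ^ i) * q ^ (-(i : ℤ))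
  firstSplit_eq : ∀ i : ℕ, 1 ≤ i → i ≤ d → Φ.firstSplit i =
    h * hstar * q ^ (1 - 2 * (i : ℤ)) * (1 - q ^ i) * (1 - q ^ ((i : ℤ) - d - 1)) *
      (1 - r * q ^ i)
  secondSplit_eq : ∀ i : ℕ, 1 ≤ i → i ≤ d → Φ.secondSplit i =
    -(h * hstar * r * q ^ (1 - (i : ℤ)) * (1 - q ^ i) * (1 - q ^ ((i : ℤ) - d - 1)))

/-- Dual `q`-Krawtchouk type. -/
structure IsDualQKrawtchouk (Φ : LeonardSystem F V d) (q h hstar s : F) : Prop where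
  ne_zero : q ≠ 0 ∧ h ≠ 0 ∧ hstar ≠ 0 ∧ s ≠ 0
  ne_one : ∀ i : ℕ, 1 ≤ i → i ≤ d → q ^ i ≠ 1
  s_ne : ∀ i : ℕ, 2 ≤ i → i ≤ 2 * d → s * q ^ i ≠ 1
  th_eq : ∀ i : ℕ, i ≤ d →
    Φ.th i = Φ.th 0 + h * (1 - q ^ i) * (1 - s * q ^ (i + 1)) * q ^ (-(i : ℤ))
  thstar_eq : ∀ i : ℕ, i ≤ d → Φ.thstar i =
    Φ.thstar 0 + hstar * (1 - q ^ i) * q ^ (-(i : ℤ))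
  firstSplit_eq : ∀ i : ℕ, 1 ≤ i → i ≤ d → Φ.firstSplit i =
    h * hstar * q ^ (1 - 2 * (i : ℤ)) * (1 - q ^ i) * (1 - q ^ ((i : ℤ) - d - 1))
  secondSplit_eq : ∀ i : ℕ, 1 ≤ i → i ≤ d → Φ.secondSplit i =
    h * hstar * s * q ^ ((d : ℤ) + 2 - 2 * (i : ℤ)) * (1 - q ^ i) * (1 - q ^ ((i : ℤ) - d - 1))

/-- Racah type. -/
structure IsRacah (Φ : LeonardSystem F V d) (h hstar s sstar r₁ r₂ : F) : Prop where
  ne_zero : h ≠ 0 ∧ hstar ≠ 0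
  r_add : r₁ + r₂ = s + sstar + d + 1
  char_cond : ringChar F = 0 ∨ ((ringChar F).Prime ∧ d < ringChar F)
  r_ne : ∀ i : ℕ, 1 ≤ i → i ≤ d →
    r₁ ≠ -(i : F) ∧ r₂ ≠ -(i : F) ∧ sstar - r₁ ≠ -(i : F) ∧ sstar - r₂ ≠ -(i : F)
  s_ne : ∀ i : ℕ, 2 ≤ i → i ≤ 2 * d → s ≠ -(i : F) ∧ sstar ≠ -(i : F)
  th_eq : ∀ i : ℕ, i ≤ d → Φ.th i = Φ.th 0 + h * i * (i + 1 + s)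
  thstar_eq : ∀ i : ℕ, i ≤ d → Φ.thstar i = Φ.thstar 0 + hstar * i * (i + 1 + sstar)
  firstSplit_eq : ∀ i : ℕ, 1 ≤ i → i ≤ d →
    Φ.firstSplit i = h * hstar * i * ((i : F) - d - 1) * (i + r₁) * (i + r₂)
  secondSplit_eq : ∀ i : ℕ, 1 ≤ i → i ≤ d →
    Φ.secondSplit i = h * hstar * i * ((i : F) - d - 1) * (i + sstar - r₁) * (i + sstar - r₂)

/-- Hahn type. -/
structure IsHahn (Φ : LeonardSystem F V d) (hstar s sstar r : F) : Prop where
  ne_zero : hstar ≠ 0 ∧ s ≠ 0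
  char_cond : ringChar F = 0 ∨ ((ringChar F).Prime ∧ d < ringChar F)
  r_ne : ∀ i : ℕ, 1 ≤ i → i ≤ d → r ≠ -(i : F) ∧ sstar - r ≠ -(i : F)
  s_ne : ∀ i : ℕ, 2 ≤ i → i ≤ 2 * d → sstar ≠ -(i : F)
  th_eq : ∀ i : ℕ, i ≤ d → Φ.th i = Φ.th 0 + s * i
  thstar_eq : ∀ i : ℕ, i ≤ d → Φ.thstar i = Φ.thstar 0 + hstar * i * (i + 1 + sstar)
  firstSplit_eq : ∀ i : ℕ, 1 ≤ i → i ≤ d →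
    Φ.firstSplit i = hstar * s * i * ((i : F) - d - 1) * (i + r)
  secondSplit_eq : ∀ i : ℕ, 1 ≤ i → i ≤ d →
    Φ.secondSplit i = -(hstar * s * i * ((i : F) - d - 1) * (i + sstar - r))

/-- Dual Hahn type. -/
structure IsDualHahn (Φ : LeonardSystem F V d) (h s sstar r : F) : Prop where
  ne_zero : h ≠ 0 ∧ sstar ≠ 0
  char_cond : ringChar F = 0 ∨ ((ringChar F).Prime ∧ d < ringChar F)
  r_ne : ∀ i : ℕ, 1 ≤ i → i ≤ d → r ≠ -(i : F) ∧ s - r ≠ -(i : F)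
  s_ne : ∀ i : ℕ, 2 ≤ i → i ≤ 2 * d → s ≠ -(i : F)
  th_eq : ∀ i : ℕ, i ≤ d → Φ.th i = Φ.th 0 + h * i * (i + 1 + s)
  thstar_eq : ∀ i : ℕ, i ≤ d → Φ.thstar i = Φ.thstar 0 + sstar * i
  firstSplit_eq : ∀ i : ℕ, 1 ≤ i → i ≤ d →
    Φ.firstSplit i = h * sstar * i * ((i : F) - d - 1) * (i + r)
  secondSplit_eq : ∀ i : ℕ, 1 ≤ i → i ≤ d →
    Φ.secondSplit i = h * sstar * i * ((i : F) - d - 1) * (i + r - s - d - 1)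

/-- Krawtchouk type. -/
structure IsKrawtchouk (Φ : LeonardSystem F V d) (s sstar r : F) : Prop where
  ne_zero : s ≠ 0 ∧ sstar ≠ 0 ∧ r ≠ 0
  char_cond : ringChar F = 0 ∨ ((ringChar F).Prime ∧ d < ringChar F)
  r_ne : r ≠ s * sstar
  th_eq : ∀ i : ℕ, i ≤ d → Φ.th i = Φ.th 0 + s * i
  thstar_eq : ∀ i : ℕ, i ≤ d → Φ.thstar i = Φ.thstar 0 + sstar * i
  firstSplit_eq : ∀ i : ℕ, 1 ≤ i → i ≤ d → Φ.firstSplit i = r * i * ((i : F) - d - 1)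
  secondSplit_eq : ∀ i : ℕ, 1 ≤ i → i ≤ d →
    Φ.secondSplit i = (r - s * sstar) * i * ((i : F) - d - 1)

/-- Bannai/Ito type. -/
structure IsBannaiIto (Φ : LeonardSystem F V d) (h hstar s sstar r₁ r₂ : F) : Prop where
  ne_zero : h ≠ 0 ∧ hstar ≠ 0
  char_cond : ringChar F = 0 ∨
    ((ringChar F).Prime ∧ Odd (ringChar F) ∧ (d : ℚ) / 2 < (ringChar F : ℚ))
  r_add : r₁ + r₂ = -s - sstar + d + 1
  r₁_ne : ∀ i : ℕ, 1 ≤ i → i ≤ d → Even (d - i) → r₁ ≠ -(i : F) ∧ -sstar - r₁ ≠ -(i : F)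
  r₂_ne : ∀ i : ℕ, 1 ≤ i → i ≤ d → Odd i → r₂ ≠ -(i : F) ∧ -sstar - r₂ ≠ -(i : F)
  s_ne : ∀ i : ℕ, 1 ≤ i → i ≤ d → s ≠ 2 * (i : F) ∧ sstar ≠ 2 * (i : F)
  th_eq : ∀ i : ℕ, i ≤ d →
    Φ.th i = Φ.th 0 + h * (s - 1 + (1 - s + 2 * i) * (-1) ^ i)
  thstar_eq : ∀ i : ℕ, i ≤ d →
    Φ.thstar i = Φ.thstar 0 + hstar * (sstar - 1 + (1 - sstar + 2 * i) * (-1) ^ i)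
  firstSplit_eq : ∀ i : ℕ, 1 ≤ i → i ≤ d →
    (Even i → Even d → Φ.firstSplit i = -4 * h * hstar * i * (i + r₁)) ∧
    (Odd i → Even d → Φ.firstSplit i = -4 * h * hstar * ((i : F) - d - 1) * (i + r₂)) ∧
    (Even i → Odd d → Φ.firstSplit i = -4 * h * hstar * i * ((i : F) - d - 1)) ∧
    (Odd i → Odd d → Φ.firstSplit i = -4 * h * hstar * (i + r₁) * (i + r₂))
  secondSplit_eq : ∀ i : ℕ, 1 ≤ i → i ≤ d →
    (Even i → Even d → Φ.secondSplit i = 4 * h * hstar * i * (i - sstar - r₁)) ∧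
    (Odd i → Even d →
      Φ.secondSplit i = 4 * h * hstar * ((i : F) - d - 1) * (i - sstar - r₂)) ∧
    (Even i → Odd d → Φ.secondSplit i = -4 * h * hstar * i * ((i : F) - d - 1)) ∧
    (Odd i → Odd d →
      Φ.secondSplit i = -4 * h * hstar * (i - sstar - r₁) * (i - sstar - r₂))

/-- Orphan type. -/
structure IsOrphan (Φ : LeonardSystem F V d) (h hstar s sstar r : F) : Prop where
  d_eq : d = 3
  char_eq : ringChar F = 2
  ne_zero : h ≠ 0 ∧ hstar ≠ 0 ∧ s ≠ 0 ∧ sstar ≠ 0 ∧ r ≠ 0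
  s_ne : s ≠ 1 ∧ sstar ≠ 1
  r_ne : r ≠ s + sstar ∧ r ≠ s * (1 + sstar) ∧ r ≠ sstar * (1 + s)
  th_eq : Φ.th 1 = Φ.th 0 + h * (s + 1) ∧ Φ.th 2 = Φ.th 0 + h ∧ Φ.th 3 = Φ.th 0 + h * s
  thstar_eq : Φ.thstar 1 = Φ.thstar 0 + hstar * (sstar + 1) ∧ Φ.thstar 2 = Φ.thstar 0 + hstar ∧
    Φ.thstar 3 = Φ.thstar 0 + hstar * sstar
  firstSplit_eq : Φ.firstSplit 1 = h * hstar * r ∧ Φ.firstSplit 2 = h * hstar ∧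
    Φ.firstSplit 3 = h * hstar * (r + s + sstar)
  secondSplit_eq : Φ.secondSplit 1 = h * hstar * (r + s + s * sstar) ∧
    Φ.secondSplit 2 = h * hstar ∧ Φ.secondSplit 3 = h * hstar * (r + sstar + s * sstar)

/-- Left-hand side of the cross-ratio equation. -/
noncomputable def lhs (Φ : LeonardSystem F V d) (i j : ℕ) : F :=
  (Φ.a i - Φ.a 0) * (Φ.thstar i - Φ.thstar d) * (Φ.a j - Φ.a d) * (Φ.thstar j - Φ.thstar 0)

/-- Right-hand side of the cross-ratio equation. -/
noncomputable def rhs (Φ : LeonardSystem F V d) (i j : ℕ) : F :=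
  (Φ.a i - Φ.a d) * (Φ.thstar i - Φ.thstar 0) * (Φ.a j - Φ.a 0) * (Φ.thstar j - Φ.thstar d)

/-- The rational expression in the dual eigenvalues. All differences in the denominator are nonzero
for `1 ≤ i, j ≤ d - 1`, since the dual eigenvalues are mutually distinct. -/
noncomputable def Q (Φ : LeonardSystem F V d) (i j : ℕ) : F :=
  ((Φ.thstar 0 - Φ.thstar i) * (Φ.thstar 0 - Φ.thstar j) * (Φ.thstar 0 - Φ.thstar d) *
    (Φ.thstar i - Φ.thstar j) * (Φ.thstar i - Φ.thstar d) * (Φ.thstar j - Φ.thstar d)) /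
  ((Φ.thstar 0 - Φ.thstar 1) * (Φ.thstar (i - 1) - Φ.thstar i) *
    (Φ.thstar i - Φ.thstar (i + 1)) * (Φ.thstar (j - 1) - Φ.thstar j) *
    (Φ.thstar j - Φ.thstar (j + 1)) * (Φ.thstar (d - 1) - Φ.thstar d))

end LeonardSystem

/-! Write T_k = θ*_k - θ*_0 and D_k = (θ*_{k-1} - θ*_k)(θ*_k - θ*_{k+1}). Comparing the split basis
with an eigenbasis of A* gives a_k = θ_k - φ_k/(θ*_{k-1} - θ*_k) + φ_{k+1}/(θ*_k - θ*_{k+1}), where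
φ is the first split sequence (`a_eq`). From there on only scalars occur.

In every type there are polynomials D and N of degree at most two with D_k = D(T_k) and (a_k - θ_0)
D_k = N(T_k) for 0 < k < d. Moreover N/D takes the values a_0 - θ_0 at T = 0 and a_d - θ_0 at T =
T_d, in cross-multiplied form. Hence, up to constants, (a_k - a_0) D_k is T_k times a linear form in
T_k, and (a_k - a_d) D_k is T_k - T_d times another. The difference of products in the theorem then
reduces to the antisymmetrization in i, j of a product of two linear forms. This is T_i - T_j times
a 2×2 determinant of coefficients, which does not depend on i and j and supplies the factor of each
type (`cross_ratio_of_linear`, `lhs_sub_rhs_of_quadratic`).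

It remains to exhibit N and D and evaluate the determinant: once for the seven q-types
(`lhs_sub_rhs_of_q`), once for Racah, Hahn, dual Hahn and Krawtchouk (`lhs_sub_rhs_of_polynomial`),
for each parity of d in Bannai/Ito type, and for the orphan type. -/

/-! ### Coordinates in triangular and eigenvector bases -/

section Triangular

variable {F : Type*} {V : Type*} [Field F] [AddCommGroup V] [Module F V]
  {ι : Type*} [Fintype ι]

/-- If the basis `b` is triangular with respect to the basis `c`, then a vector whose `c`-coordinates
vanish from some index on has `b`-coordinates vanishing from that index on. The order on the index
type is given by an injective map to `ℤ`. -/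
theorem Module.Basis.repr_eq_zero_of_triangular (b c : Module.Basis ι F V) (ρ : ι → ℤ)
    (hρ : Function.Injective ρ) (hzero : ∀ j k, ρ k < ρ j → c.repr (b k) j = 0)
    (hdiag : ∀ k, c.repr (b k) k ≠ 0) (x : V) (m : ℤ) (hx : ∀ j, m ≤ ρ j → c.repr x j = 0)
    (k : ι) (hk : m ≤ ρ k) : b.repr x k = 0 := by
  classical
  by_contra hne
  -- At a maximal offending index `l`, only `b l` contributes to the `l`-th `c`-coordinate of `x`:
  -- later `b`-coordinates of `x` vanish by maximality, and earlier `b j` have no `l`-th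
  -- `c`-coordinate.
  obtain ⟨l, hl, hmax⟩ := (Finset.univ.filter fun k => m ≤ ρ k ∧ b.repr x k ≠ 0).exists_max_image ρ
    ⟨k, by simp [hk, hne]⟩
  simp only [Finset.mem_filter, Finset.mem_univ, true_and] at hl hmax
  have h := hx l hl.1
  rw [← b.sum_repr x, map_sum, Finsupp.finsetSum_apply, Finset.sum_eq_single l] at h
  · rw [map_smul, Finsupp.smul_apply, smul_eq_mul] at h
    exact (mul_ne_zero hl.2 (hdiag l)) h
  · intro j _ hj
    rw [map_smul, Finsupp.smul_apply, smul_eq_mul]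
    rcases lt_trichotomy (ρ j) (ρ l) with h1 | h1 | h1
    · rw [hzero _ _ h1, mul_zero]
    · exact absurd (hρ h1) hj
    · by_cases h0 : b.repr x j = 0
      · rw [h0, zero_mul]
      · exact absurd (hmax j ⟨hl.1.trans h1.le, h0⟩) (not_le.2 h1)
  · simp

theorem Module.Basis.repr_apply_end (v : Module.Basis ι F V) [DecidableEq ι] (A : Module.End F V)
    (x : V) (j : ι) : v.repr (A x) j = ∑ k, LinearMap.toMatrix v v A j k * v.repr x k := by
  rw [← congrFun (LinearMap.toMatrix_mulVec_repr v v A x) j]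
  rfl

theorem Module.Basis.repr_apply_of_eigen (v : Module.Basis ι F V) (A : Module.End F V)
    (θ : ι → F) (h : ∀ i, A (v i) = θ i • v i) (x : V) (j : ι) :
    v.repr (A x) j = θ j * v.repr x j := by
  conv_lhs => rw [← v.sum_repr x, map_sum, map_sum, Finsupp.finsetSum_apply]
  rw [Finset.sum_eq_single j]
  · simp [h, mul_comm]
  · intro k _ hk
    simp [h, hk]
  · simp

end Triangular

/-! ### The split basis and the formula for a_i -/

namespace LeonardSystem

variable {F : Type u} {V : Type v} [Field F] [AddCommGroup V] [Module F V] {d : ℕ}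

theorem th_coe (Φ : LeonardSystem F V d) (i : Fin (d + 1)) :
    Φ.th i = Classical.choose Φ.standard i := by
  simp only [th, i.2, dif_pos, Fin.eta]

theorem thstar_coe (Φ : LeonardSystem F V d) (i : Fin (d + 1)) :
    Φ.thstar i = Classical.choose Φ.standard_star i := by
  simp only [thstar, i.2, dif_pos, Fin.eta]

theorem thstar_ne (Φ : LeonardSystem F V d) {i j : ℕ} (hi : i ≤ d) (hj : j ≤ d) (hij : i ≠ j) :
    Φ.thstar i - Φ.thstar j ≠ 0 := by
  have h := (Classical.choose_spec Φ.standard_star).1.injective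
  rw [sub_ne_zero]
  have e1 := Φ.thstar_coe ⟨i, by omega⟩
  have e2 := Φ.thstar_coe ⟨j, by omega⟩
  simp only at e1 e2
  rw [e1, e2]
  intro h'
  exact hij (by simpa using h h')

theorem exists_basis (Φ : LeonardSystem F V d) : ∃ y : Module.Basis (Fin (d + 1)) F V,
    (∀ i : Fin (d + 1), Φ.A (y i) = Φ.th i • y i) ∧
      IsIrreducibleTridiagonal (LinearMap.toMatrix y y Φ.Astar) := by
  obtain ⟨y, hy, hM⟩ := (Classical.choose_spec Φ.standard).1.exists_eigenbasis
  exact ⟨y, fun i => by rw [th_coe]; exact hy i, hM⟩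

theorem exists_basis_star (Φ : LeonardSystem F V d) : ∃ v : Module.Basis (Fin (d + 1)) F V,
    (∀ i : Fin (d + 1), Φ.Astar (v i) = Φ.thstar i • v i) ∧
      (∀ i j : Fin (d + 1), Φ.Estar i (v j) = if j = i then v j else 0) ∧
      IsIrreducibleTridiagonal (LinearMap.toMatrix v v Φ.A) := by
  have hs := Classical.choose_spec Φ.standard_star
  obtain ⟨v, hv, hM⟩ := hs.1.exists_eigenbasis
  exact ⟨v, fun i => by rw [thstar_coe]; exact hv i,
    fun i j => hs.2 i j _ (Module.End.mem_eigenspace_iff.2 (hv j)), hM⟩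

/-- The vector `τ_n(A) w` for an arbitrary natural number `n`. -/
noncomputable def splitVec (Φ : LeonardSystem F V d) (w : V) (n : ℕ) : V :=
  Polynomial.aeval Φ.A (∏ k ∈ Finset.range n, (Polynomial.X - Polynomial.C (Φ.th k))) w

theorem splitVec_zero (Φ : LeonardSystem F V d) (w : V) : Φ.splitVec w 0 = w := by
  simp [splitVec]

theorem splitVec_succ (Φ : LeonardSystem F V d) (w : V) (n : ℕ) :
    Φ.splitVec w (n + 1) = Φ.A (Φ.splitVec w n) - Φ.th n • Φ.splitVec w n := by
  simp only [splitVec]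
  rw [Finset.prod_range_succ, mul_comm, map_mul]
  simp [Module.algebraMap_end_apply]

theorem splitBasis_apply (Φ : LeonardSystem F V d) (w : V)
    (hw : w ∈ LinearMap.range (Φ.Estar 0)) (hw0 : w ≠ 0) (i : Fin (d + 1)) :
    Φ.splitBasis w hw hw0 i = Φ.splitVec w i := by
  simp [splitBasis, splitVector, splitVec]

theorem repr_splitVec (Φ : LeonardSystem F V d) (y : Module.Basis (Fin (d + 1)) F V)
    (hy : ∀ i : Fin (d + 1), Φ.A (y i) = Φ.th i • y i) (w : V) (n : ℕ) (j : Fin (d + 1)) :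
    y.repr (Φ.splitVec w n) j = (∏ k ∈ Finset.range n, (Φ.th j - Φ.th k)) * y.repr w j := by
  induction n with
  | zero => simp [splitVec_zero]
  | succ n ih =>
    rw [splitVec_succ, map_sub, map_smul, Finsupp.sub_apply, Finsupp.smul_apply,
      y.repr_apply_of_eigen _ _ hy, ih, Finset.prod_range_succ, smul_eq_mul]
    ring

theorem repr_splitVec_of_lt (Φ : LeonardSystem F V d) (y : Module.Basis (Fin (d + 1)) F V)
    (hy : ∀ i : Fin (d + 1), Φ.A (y i) = Φ.th i • y i) (w : V) (n : ℕ) (j : Fin (d + 1))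
    (h : (j : ℕ) < n) : y.repr (Φ.splitVec w n) j = 0 := by
  rw [repr_splitVec Φ y hy, Finset.prod_eq_zero (Finset.mem_range.2 h) (sub_self _), zero_mul]

theorem splitVec_last (Φ : LeonardSystem F V d) (w : V) : Φ.splitVec w (d + 1) = 0 := by
  obtain ⟨y, hy, -⟩ := Φ.exists_basis
  apply y.repr.injective
  ext j
  rw [repr_splitVec_of_lt Φ y hy w _ j j.2]
  simp

/-- If the `k`-th coordinate of `w` were zero, the coordinate functional would kill every τ_n(A) w,
hence everything, since these vectors form a basis. The remaining factors are differences of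
distinct eigenvalues. -/
theorem repr_splitVec_self_ne_zero (Φ : LeonardSystem F V d) (y : Module.Basis (Fin (d + 1)) F V)
    (hy : ∀ i : Fin (d + 1), Φ.A (y i) = Φ.th i • y i) (w : V)
    (hw : w ∈ LinearMap.range (Φ.Estar 0)) (hw0 : w ≠ 0) (k : Fin (d + 1)) :
    y.repr (Φ.splitVec w k) k ≠ 0 := by
  have hinj := (Classical.choose_spec Φ.standard).1.injective
  have hwk : y.repr w k ≠ 0 := by
    intro h
    have : y.coord k = 0 := by
      apply (Φ.splitBasis w hw hw0).ext
      intro i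
      rw [splitBasis_apply, Module.Basis.coord_apply, repr_splitVec Φ y hy, h, mul_zero,
        LinearMap.zero_apply]
    have h1 : y.coord k (y k) = 0 := by rw [this, LinearMap.zero_apply]
    simp at h1
  rw [repr_splitVec Φ y hy]
  refine mul_ne_zero (Finset.prod_ne_zero_iff.2 fun l hl => ?_) hwk
  have hl' := Finset.mem_range.1 hl
  have e := Φ.th_coe ⟨l, by omega⟩
  simp only at e
  rw [sub_ne_zero, e, th_coe]
  intro h
  have := congrArg Fin.val (hinj h)
  simp only at this
  omega

/-- In an eigenbasis of `A*` in standard order, split vectors have triangular coordinates. -/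
theorem repr_star_splitVec (Φ : LeonardSystem F V d) (v : Module.Basis (Fin (d + 1)) F V)
    (hE : ∀ i j : Fin (d + 1), Φ.Estar i (v j) = if j = i then v j else 0)
    (hM : IsIrreducibleTridiagonal (LinearMap.toMatrix v v Φ.A)) (w : V)
    (hw : w ∈ LinearMap.range (Φ.Estar 0)) (n : ℕ) (j : Fin (d + 1)) (h : n < (j : ℕ)) :
    v.repr (Φ.splitVec w n) j = 0 := by
  induction n generalizing j with
  | zero =>
    obtain ⟨x, rfl⟩ := hw
    rw [splitVec_zero, ← v.sum_repr x, map_sum, map_sum, Finsupp.finsetSum_apply]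
    refine Finset.sum_eq_zero fun k _ => ?_
    rw [map_smul, hE 0 k]
    by_cases hk : k = 0
    · subst hk
      have : j ≠ 0 := by rintro rfl; simp at h
      simp [this.symm]
    · simp [hk]
  | succ n ih =>
    rw [splitVec_succ, map_sub, map_smul, Finsupp.sub_apply, Finsupp.smul_apply,
      ih j (by omega), smul_zero, sub_zero, v.repr_apply_end]
    refine Finset.sum_eq_zero fun k _ => ?_
    by_cases hk : n < (k : ℕ)
    · rw [ih k hk, mul_zero]
    · rw [(hM j k).1 (Or.inr (by omega)), zero_mul]

/-- Each application of A moves the top coordinate up by one and multiplies it by a subdiagonal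
entry, nonzero by irreducibility. -/
theorem repr_star_splitVec_self_ne_zero (Φ : LeonardSystem F V d)
    (v : Module.Basis (Fin (d + 1)) F V)
    (hE : ∀ i j : Fin (d + 1), Φ.Estar i (v j) = if j = i then v j else 0)
    (hM : IsIrreducibleTridiagonal (LinearMap.toMatrix v v Φ.A)) (w : V)
    (hw : w ∈ LinearMap.range (Φ.Estar 0)) (hw0 : w ≠ 0) (n : ℕ) (hn : n < d + 1) :
    v.repr (Φ.splitVec w n) ⟨n, hn⟩ ≠ 0 := by
  induction n with
  | zero =>
    intro h
    apply hw0
    apply v.repr.injective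
    ext j
    rw [splitVec_zero] at h
    by_cases hj : j = 0
    · subst hj; simpa using h
    · have := Φ.repr_star_splitVec v hE hM w hw 0 j (Nat.pos_of_ne_zero fun h0 => hj (Fin.ext h0))
      rw [splitVec_zero] at this
      simpa using this
  | succ n ih =>
    rw [splitVec_succ, map_sub, map_smul, Finsupp.sub_apply, Finsupp.smul_apply,
      Φ.repr_star_splitVec v hE hM w hw n _ (by simp), smul_zero, sub_zero, v.repr_apply_end,
      Finset.sum_eq_single ⟨n, by omega⟩]
    · exact mul_ne_zero ((hM _ _).2 (Or.inr rfl)) (ih _)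
    · intro k _ hk
      rcases lt_trichotomy (k : ℕ) n with h | h | h
      · rw [(hM _ k).1 (Or.inr (by simpa using h)), zero_mul]
      · exact absurd (Fin.ext h) hk
      · rw [Φ.repr_star_splitVec v hE hM w hw n k h, mul_zero]
    · simp

/-- In an eigenbasis of A* the idempotent is a diagonal matrix unit, so the trace picks out one
diagonal entry. -/
theorem trace_Estar_mul (Φ : LeonardSystem F V d) (v : Module.Basis (Fin (d + 1)) F V)
    (hE : ∀ i j : Fin (d + 1), Φ.Estar i (v j) = if j = i then v j else 0) (i : Fin (d + 1)) :
    Φ.a i = LinearMap.toMatrix v v Φ.A i i := by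
  have hE' : ∀ x j, v.repr (Φ.Estar i x) j = (if j = i then 1 else 0) * v.repr x j :=
    v.repr_apply_of_eigen (Φ.Estar i) (fun j => if j = i then 1 else 0) fun j => by
      rw [hE]; split_ifs <;> simp
  simp only [a, i.2, dif_pos, Fin.eta]
  rw [LinearMap.trace_eq_matrix_trace F v, Matrix.trace]
  simp [LinearMap.toMatrix_apply, hE']

/-- `A*` acts on a split basis as an upper bidiagonal matrix. -/
theorem exists_splitVec (Φ : LeonardSystem F V d) : ∃ w : V, w ∈ LinearMap.range (Φ.Estar 0) ∧
    w ≠ 0 ∧ ∀ n : ℕ, n + 1 ≤ d → Φ.Astar (Φ.splitVec w (n + 1)) =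
      Φ.thstar (n + 1) • Φ.splitVec w (n + 1) + Φ.firstSplit (n + 1) • Φ.splitVec w n := by
  refine ⟨_, (Classical.choose_spec Φ.exists_mem_range_Estar_zero).1,
    (Classical.choose_spec Φ.exists_mem_range_Estar_zero).2, fun n hn => ?_⟩
  have hw := (Classical.choose_spec Φ.exists_mem_range_Estar_zero).1
  have hw0 := (Classical.choose_spec Φ.exists_mem_range_Estar_zero).2
  -- Once the split sequence is expressed as a coordinate, the chosen vector can be generalized to
  -- any nonzero `w` in the range.
  have hφ : Φ.firstSplit (n + 1) = (Φ.splitBasis _ hw hw0).repr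
      (Φ.Astar (Φ.splitVec (Classical.choose Φ.exists_mem_range_Estar_zero) (n + 1)))
      ⟨n, by omega⟩ := by
    simp only [firstSplit]
    rw [dif_pos ⟨by omega, hn⟩, LinearMap.toMatrix_apply, splitBasis_apply]
    rfl
  rw [hφ]
  generalize Classical.choose Φ.exists_mem_range_Estar_zero = w at hw hw0 hφ ⊢
  clear hφ
  obtain ⟨y, hy, hyM⟩ := Φ.exists_basis
  obtain ⟨v, hv, hE, hvM⟩ := Φ.exists_basis_star
  set b := Φ.splitBasis w hw hw0 with hb
  have hbs : ∀ i : Fin (d + 1), b i = Φ.splitVec w i := Φ.splitBasis_apply w hw hw0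
  -- The goal amounts to `x` being a multiple of τ_n(A) w. The two eigenbases each bound its
  -- coordinates in the split basis from one side.
  set x := Φ.Astar (Φ.splitVec w (n + 1)) - Φ.thstar (n + 1) • Φ.splitVec w (n + 1) with hx
  -- In the eigenbasis of A* the vector τ_{n+1}(A) w has no coordinate beyond n + 1, and subtracting
  -- θ*_{n+1} kills the one at n + 1.
  have hup : ∀ k : Fin (d + 1), n + 1 ≤ (k : ℕ) → b.repr x k = 0 := by
    intro k hk
    refine b.repr_eq_zero_of_triangular v (fun i => (i : ℤ)) ?_ ?_ ?_ x (n + 1) ?_ k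
      (by exact_mod_cast hk)
    · intro i j hij; exact Fin.ext (by simpa using hij)
    · intro j k hjk
      rw [hbs]
      exact Φ.repr_star_splitVec v hE hvM w hw k j (by exact_mod_cast hjk)
    · intro k
      rw [hbs]
      exact Φ.repr_star_splitVec_self_ne_zero v hE hvM w hw hw0 k k.2
    · intro j hj
      have hj' : n + 1 ≤ (j : ℕ) := by exact_mod_cast hj
      rw [hx, map_sub, map_smul, Finsupp.sub_apply, Finsupp.smul_apply,
        v.repr_apply_of_eigen _ _ hv, smul_eq_mul, ← sub_mul]
      rcases hj'.eq_or_lt with h | h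
      · rw [← h, sub_self, zero_mul]
      · rw [Φ.repr_star_splitVec v hE hvM w hw _ j h, mul_zero]
  -- In the eigenbasis of A the vector τ_{n+1}(A) w starts at index n + 1, and the tridiagonal A*
  -- lowers this by at most one. The order is reversed by i ↦ -i, so the bound -n + 1 means i < n.
  have hlow : ∀ k : Fin (d + 1), (k : ℕ) < n → b.repr x k = 0 := by
    intro k hk
    refine b.repr_eq_zero_of_triangular y (fun i => -(i : ℤ)) ?_ ?_ ?_ x (-n + 1) ?_ k (by omega)
    · intro i j hij; exact Fin.ext (by simpa using hij)
    · intro j k hjk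
      rw [hbs]
      exact Φ.repr_splitVec_of_lt y hy w k j (by omega)
    · intro k
      rw [hbs]
      exact Φ.repr_splitVec_self_ne_zero y hy w hw hw0 k
    · intro j hj
      rw [hx, map_sub, map_smul, Finsupp.sub_apply, Finsupp.smul_apply,
        Φ.repr_splitVec_of_lt y hy w _ j (by omega), smul_zero, sub_zero, y.repr_apply_end]
      refine Finset.sum_eq_zero fun l _ => ?_
      by_cases hl : (l : ℕ) < n + 1
      · rw [Φ.repr_splitVec_of_lt y hy w _ l hl, mul_zero]
      · rw [(hyM j l).1 (Or.inl (by omega)), zero_mul]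
  have hself : b.repr (Φ.splitVec w (n + 1)) ⟨n, by omega⟩ = 0 := by
    have := hbs ⟨n + 1, by omega⟩
    simp only at this
    rw [← this, b.repr_self]
    simp
  have hxn : x = b.repr x ⟨n, by omega⟩ • Φ.splitVec w n := by
    conv_lhs => rw [← b.sum_repr x]
    rw [Finset.sum_eq_single ⟨n, by omega⟩, hbs]
    · intro k _ hk
      rcases lt_trichotomy (k : ℕ) n with h | h | h
      · rw [hlow k h, zero_smul]
      · exact absurd (Fin.ext h) hk
      · rw [hup k h, zero_smul]
    · simp
  have hcoef : b.repr x ⟨n, by omega⟩ = b.repr (Φ.Astar (Φ.splitVec w (n + 1))) ⟨n, by omega⟩ := by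
    rw [hx, map_sub, map_smul, Finsupp.sub_apply, Finsupp.smul_apply, hself, smul_zero, sub_zero]
  rw [← hcoef, ← hxn, hx]
  abel

/-- Together with the value 0 at index 0, this lets one formula for a_i cover both ends: at i = 0
(where i - 1 truncates to 0) and at i = d (where θ*_{d+1} is a default value) the doubtful quotient
has numerator 0. -/
theorem firstSplit_of_gt (Φ : LeonardSystem F V d) {i : ℕ} (hi : d < i) : Φ.firstSplit i = 0 := by
  rw [firstSplit, dif_neg (by omega)]

theorem firstSplit_zero (Φ : LeonardSystem F V d) : Φ.firstSplit 0 = 0 := by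
  rw [firstSplit, dif_neg (by omega)]

/-- The expression of `a_i` through the eigenvalues and the first split sequence. -/
theorem a_eq (Φ : LeonardSystem F V d) {i : ℕ} (hi : i ≤ d) :
    Φ.a i = Φ.th i - Φ.firstSplit i / (Φ.thstar (i - 1) - Φ.thstar i) +
      Φ.firstSplit (i + 1) / (Φ.thstar i - Φ.thstar (i + 1)) := by
  obtain ⟨w, hw, hw0, hb⟩ := Φ.exists_splitVec
  obtain ⟨v, hv, hE, hM⟩ := Φ.exists_basis_star
  set c : ℕ → F := fun n => if h : n < d + 1 then v.repr (Φ.splitVec w n) ⟨n, h⟩ else 0 with hc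
  have hc0 : c i ≠ 0 := by
    simp only [hc]
    rw [dif_pos (by omega)]
    exact Φ.repr_star_splitVec_self_ne_zero v hE hM w hw hw0 i (by omega)
  -- the entry just above the diagonal
  have habove : ∀ n (hn : n + 1 ≤ d), v.repr (Φ.splitVec w (n + 1)) ⟨n, by omega⟩ =
      Φ.firstSplit (n + 1) * c n / (Φ.thstar n - Φ.thstar (n + 1)) := by
    intro n hn
    have h := congrArg (fun x => v.repr x ⟨n, by omega⟩) (hb n hn)
    simp only [map_add, map_smul, Finsupp.add_apply, Finsupp.smul_apply, smul_eq_mul] at h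
    rw [v.repr_apply_of_eigen _ _ hv] at h
    rw [eq_div_iff (Φ.thstar_ne (by omega) hn (by omega))]
    have : c n = v.repr (Φ.splitVec w n) ⟨n, by omega⟩ := by
      simp only [hc]; rw [dif_pos]
    rw [this]
    simp only at h
    linear_combination h
  have hAi : ∀ n, ∀ hn : n < d + 1, ∀ j : Fin (d + 1), v.repr (Φ.A (Φ.splitVec w n)) j =
      Φ.th n * v.repr (Φ.splitVec w n) j + v.repr (Φ.splitVec w (n + 1)) j := by
    intro n hn j
    rw [splitVec_succ, map_sub, map_smul, Finsupp.sub_apply, Finsupp.smul_apply, smul_eq_mul]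
    ring
  have hnext : v.repr (Φ.splitVec w (i + 1)) ⟨i, by omega⟩ =
      Φ.firstSplit (i + 1) * c i / (Φ.thstar i - Φ.thstar (i + 1)) := by
    rcases hi.eq_or_lt with h | h
    · subst h
      rw [splitVec_last, Φ.firstSplit_of_gt (by omega)]
      simp
    · exact habove i h
  have hci : c i = v.repr (Φ.splitVec w i) ⟨i, by omega⟩ := by
    simp only [hc]; rw [dif_pos]
  -- The formula is the `i`-th coordinate of A u_i = θ_i u_i + u_{i+1}, where u_n = τ_n(A) w,
  -- divided by c i.
  have hmain := hAi i (by omega) ⟨i, by omega⟩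
  rw [hnext, ← hci, v.repr_apply_end] at hmain
  have ha := Φ.trace_Estar_mul v hE ⟨i, by omega⟩
  simp only at ha
  have hsum : ∑ k, LinearMap.toMatrix v v Φ.A ⟨i, by omega⟩ k * v.repr (Φ.splitVec w i) k =
      Φ.a i * c i + Φ.firstSplit i * c i / (Φ.thstar (i - 1) - Φ.thstar i) := by
    rcases Nat.eq_zero_or_pos i with h | h
    · subst h
      rw [Finset.sum_eq_single ⟨0, by omega⟩, ha, hci, Φ.firstSplit_zero]
      · simp
      · intro k _ hk
        rw [Φ.repr_star_splitVec v hE hM w hw 0 k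
          (Nat.pos_of_ne_zero fun h0 => hk (Fin.ext h0)), mul_zero]
      · simp
    · obtain ⟨m, rfl⟩ := Nat.exists_eq_succ_of_ne_zero h.ne'
      have hne : (⟨m, by omega⟩ : Fin (d + 1)) ≠ ⟨m + 1, by omega⟩ := by simp
      rw [Finset.sum_eq_add (⟨m, by omega⟩ : Fin (d + 1)) ⟨m + 1, by omega⟩ hne]
      -- The subdiagonal entry of A is eliminated: the coordinate m + 1 of A u_m = θ_m u_m + u_{m+1}
      -- says that this entry times c m is c (m + 1).
      · have hcm := hAi m (by omega) ⟨m + 1, by omega⟩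
        rw [Φ.repr_star_splitVec v hE hM w hw m _ (by simp), mul_zero, zero_add, v.repr_apply_end,
          Finset.sum_eq_single ⟨m, by omega⟩] at hcm
        · have hcm' : c m = v.repr (Φ.splitVec w m) ⟨m, by omega⟩ := by
            simp only [hc]; rw [dif_pos]
          have e := habove m (by omega)
          rw [← hcm'] at hcm
          simp only [Nat.succ_eq_add_one, Nat.add_sub_cancel] at *
          rw [e, ha, hci, ← hcm]
          ring
        · intro k _ hk
          rcases lt_trichotomy (k : ℕ) m with h' | h' | h'
          · rw [(hM _ k).1 (Or.inr (by simpa using h')), zero_mul]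
          · exact absurd (Fin.ext h') hk
          · rw [Φ.repr_star_splitVec v hE hM w hw m k h', mul_zero]
        · simp
      · intro k _ hk
        rcases lt_trichotomy (k : ℕ) m with h' | h' | h'
        · rw [(hM _ k).1 (Or.inr (by simpa using h')), zero_mul]
        · exact absurd (Fin.ext h') hk.1
        · have : (k : ℕ) ≠ m + 1 := fun h0 => hk.2 (Fin.ext h0)
          rw [Φ.repr_star_splitVec v hE hM w hw _ k (by omega), mul_zero]
      · simp
      · simp
  rw [hsum] at hmain
  apply mul_right_cancel₀ hc0
  linear_combination hmain

end LeonardSystem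

/-! ### From quadratic polynomials in the dual eigenvalues to the cross-ratio identity -/

namespace LeonardSystem

variable {F : Type u} {V : Type v} [Field F] [AddCommGroup V] [Module F V] {d : ℕ}

/-- After clearing denominators everything rests on (κ0 + κ1 Ti)(μ0 + μ1 Tj) - (κ0 + κ1 Tj)(μ0 + μ1
Ti) = (κ1 μ0 - κ0 μ1)(Ti - Tj). The factor -Td is split off the determinant to match the numerator
of `Q`. -/
theorem cross_ratio_of_linear {ai aj a0 ad Ti Tj Td Di Dj δ0 δd κ0 κ1 μ0 μ1 f : F}
    (hDi : Di ≠ 0) (hDj : Dj ≠ 0) (h0 : δ0 ≠ 0) (hd : δd ≠ 0)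
    (hi0 : (ai - a0) * (δ0 * Di) = Ti * (κ0 + κ1 * Ti))
    (hj0 : (aj - a0) * (δ0 * Dj) = Tj * (κ0 + κ1 * Tj))
    (hid : (ai - ad) * (δd * Di) = (Ti - Td) * (μ0 + μ1 * Ti))
    (hjd : (aj - ad) * (δd * Dj) = (Tj - Td) * (μ0 + μ1 * Tj))
    (hf : κ1 * μ0 - κ0 * μ1 = -Td * f) :
    (ai - a0) * (Ti - Td) * (aj - ad) * Tj - (ai - ad) * Ti * (aj - a0) * (Tj - Td) =
      -(Ti * Tj * Td * (Ti - Tj) * (Ti - Td) * (Tj - Td)) / (δ0 * Di * Dj * δd) * f := by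
  have h1 : (ai - a0) * (δ0 * Di) * ((aj - ad) * (δd * Dj)) =
    Ti * (κ0 + κ1 * Ti) * ((Tj - Td) * (μ0 + μ1 * Tj)) := by rw [hi0, hjd]
  have h2 : (aj - a0) * (δ0 * Dj) * ((ai - ad) * (δd * Di)) =
    Tj * (κ0 + κ1 * Tj) * ((Ti - Td) * (μ0 + μ1 * Ti)) := by rw [hj0, hid]
  rw [div_mul_eq_mul_div, eq_div_iff (by simp [hDi, hDj, h0, hd])]
  linear_combination (Ti - Td) * Tj * h1 - Ti * (Tj - Td) * h2 +
    Ti * Tj * (Ti - Tj) * (Ti - Td) * (Tj - Td) * hf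

/-- The cross-ratio identity, once `a_k` is known to be a ratio of two quadratic polynomials in
`θ*_k`. -/
theorem lhs_sub_rhs_of_quadratic (hd : 3 ≤ d) (Φ : LeonardSystem F V d) {i j : ℕ}
    (hi : 1 ≤ i) (hi' : i ≤ d - 1) (hj : 1 ≤ j) (hj' : j ≤ d - 1) (n₀ n₁ n₂ d₀ d₁ d₂ f P : F)
    (hD : ∀ k, 1 ≤ k → k + 1 ≤ d →
      (Φ.thstar (k - 1) - Φ.thstar k) * (Φ.thstar k - Φ.thstar (k + 1)) =
        d₀ + d₁ * (Φ.thstar k - Φ.thstar 0) + d₂ * (Φ.thstar k - Φ.thstar 0) ^ 2)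
    (hN : ∀ k, 1 ≤ k → k + 1 ≤ d →
      (Φ.th k - Φ.th 0) *
          ((Φ.thstar (k - 1) - Φ.thstar k) * (Φ.thstar k - Φ.thstar (k + 1))) -
        Φ.firstSplit k * (Φ.thstar k - Φ.thstar (k + 1)) +
        Φ.firstSplit (k + 1) * (Φ.thstar (k - 1) - Φ.thstar k) =
        n₀ + n₁ * (Φ.thstar k - Φ.thstar 0) + n₂ * (Φ.thstar k - Φ.thstar 0) ^ 2)
    (h0 : n₀ * (Φ.thstar 0 - Φ.thstar 1) = Φ.firstSplit 1 * d₀)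
    (hP : P = (Φ.th d - Φ.th 0) * (Φ.thstar (d - 1) - Φ.thstar d) - Φ.firstSplit d)
    (hlast : (n₀ + n₁ * (Φ.thstar d - Φ.thstar 0) + n₂ * (Φ.thstar d - Φ.thstar 0) ^ 2) *
        (Φ.thstar (d - 1) - Φ.thstar d) =
      P * (d₀ + d₁ * (Φ.thstar d - Φ.thstar 0) + d₂ * (Φ.thstar d - Φ.thstar 0) ^ 2))
    (hf : (n₂ * (Φ.thstar 0 - Φ.thstar 1) - Φ.firstSplit 1 * d₂) *
          (n₁ * (Φ.thstar (d - 1) - Φ.thstar d) - P * d₁ +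
            (n₂ * (Φ.thstar (d - 1) - Φ.thstar d) - P * d₂) * (Φ.thstar d - Φ.thstar 0)) -
        (n₁ * (Φ.thstar 0 - Φ.thstar 1) - Φ.firstSplit 1 * d₁) *
          (n₂ * (Φ.thstar (d - 1) - Φ.thstar d) - P * d₂) =
      -(Φ.thstar d - Φ.thstar 0) * f) :
    Φ.lhs i j - Φ.rhs i j = Φ.Q i j * f := by
  have hδ0 := Φ.thstar_ne (i := 0) (j := 1) (by omega) (by omega) (by omega)
  have hδd := Φ.thstar_ne (i := d - 1) (j := d) (by omega) (by omega) (by omega)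
  have ha0 : (Φ.a 0 - Φ.th 0) * (Φ.thstar 0 - Φ.thstar 1) = Φ.firstSplit 1 := by
    rw [Φ.a_eq (Nat.zero_le d), Φ.firstSplit_zero]
    field_simp
    ring
  have had : (Φ.a d - Φ.th 0) * (Φ.thstar (d - 1) - Φ.thstar d) = P := by
    rw [Φ.a_eq le_rfl, Φ.firstSplit_of_gt (Nat.lt_succ_self d), hP]
    field_simp
    ring
  have hDne : ∀ k, 1 ≤ k → k + 1 ≤ d →
      (Φ.thstar (k - 1) - Φ.thstar k) * (Φ.thstar k - Φ.thstar (k + 1)) ≠ 0 := fun k hk hk' =>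
    mul_ne_zero (Φ.thstar_ne (by omega) (by omega) (by omega))
      (Φ.thstar_ne (by omega) (by omega) (by omega))
  have ha : ∀ k, 1 ≤ k → k + 1 ≤ d → (Φ.a k - Φ.th 0) *
      ((Φ.thstar (k - 1) - Φ.thstar k) * (Φ.thstar k - Φ.thstar (k + 1))) =
        n₀ + n₁ * (Φ.thstar k - Φ.thstar 0) + n₂ * (Φ.thstar k - Φ.thstar 0) ^ 2 := by
    intro k hk hk'
    have h1 := Φ.thstar_ne (i := k - 1) (j := k) (by omega) (by omega) (by omega)
    have h2 := Φ.thstar_ne (i := k) (j := k + 1) (by omega) (by omega) (by omega)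
    rw [← hN k hk hk', Φ.a_eq (by omega : k ≤ d)]
    field_simp
    ring
  -- With N and D the two quadratics, `h0` says that N(T)(θ*_0 - θ*_1) - φ_1 D(T) has no constant
  -- term, so T divides it. No division by D(0) is made, as it may vanish.
  have hk0 : ∀ k, 1 ≤ k → k + 1 ≤ d → (Φ.a k - Φ.a 0) * ((Φ.thstar 0 - Φ.thstar 1) *
      ((Φ.thstar (k - 1) - Φ.thstar k) * (Φ.thstar k - Φ.thstar (k + 1)))) =
      (Φ.thstar k - Φ.thstar 0) * ((n₁ * (Φ.thstar 0 - Φ.thstar 1) - Φ.firstSplit 1 * d₁) +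
        (n₂ * (Φ.thstar 0 - Φ.thstar 1) - Φ.firstSplit 1 * d₂) *
          (Φ.thstar k - Φ.thstar 0)) := by
    intro k hk hk'
    have h1 := ha k hk hk'
    have h2 := hD k hk hk'
    linear_combination (Φ.thstar 0 - Φ.thstar 1) * h1 -
      ((Φ.thstar (k - 1) - Φ.thstar k) * (Φ.thstar k - Φ.thstar (k + 1))) * ha0 -
      Φ.firstSplit 1 * h2 + h0
  -- Likewise `hlast` makes T_d a root of N(T)(θ*_{d-1} - θ*_d) - P D(T). The linear form is the
  -- cofactor: αT² + βT + γ with root T_d equals (T - T_d)(αT + β + αT_d).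
  have hkd : ∀ k, 1 ≤ k → k + 1 ≤ d → (Φ.a k - Φ.a d) * ((Φ.thstar (d - 1) - Φ.thstar d) *
      ((Φ.thstar (k - 1) - Φ.thstar k) * (Φ.thstar k - Φ.thstar (k + 1)))) =
      ((Φ.thstar k - Φ.thstar 0) - (Φ.thstar d - Φ.thstar 0)) *
        ((n₁ * (Φ.thstar (d - 1) - Φ.thstar d) - P * d₁ +
            (n₂ * (Φ.thstar (d - 1) - Φ.thstar d) - P * d₂) * (Φ.thstar d - Φ.thstar 0)) +
        (n₂ * (Φ.thstar (d - 1) - Φ.thstar d) - P * d₂) * (Φ.thstar k - Φ.thstar 0)) := by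
    intro k hk hk'
    have h1 := ha k hk hk'
    have h2 := hD k hk hk'
    linear_combination (Φ.thstar (d - 1) - Φ.thstar d) * h1 -
      ((Φ.thstar (k - 1) - Φ.thstar k) * (Φ.thstar k - Φ.thstar (k + 1))) * had -
      P * h2 + hlast
  have key := cross_ratio_of_linear (hDne i hi (by omega)) (hDne j hj (by omega)) hδ0 hδd
    (hk0 i hi (by omega)) (hk0 j hj (by omega)) (hkd i hi (by omega)) (hkd j hj (by omega)) hf
  have hl : Φ.lhs i j - Φ.rhs i j = (Φ.a i - Φ.a 0) *
      ((Φ.thstar i - Φ.thstar 0) - (Φ.thstar d - Φ.thstar 0)) * (Φ.a j - Φ.a d) *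
      (Φ.thstar j - Φ.thstar 0) - (Φ.a i - Φ.a d) * (Φ.thstar i - Φ.thstar 0) *
      (Φ.a j - Φ.a 0) * ((Φ.thstar j - Φ.thstar 0) - (Φ.thstar d - Φ.thstar 0)) := by
    simp only [lhs, rhs]
    ring
  rw [hl, key, Q]
  congr 2 <;> ring

/-! ### The seven q-types -/

/-- A common parametrization: q-Racah is the general shape, with its condition on r₁r₂ absorbed in
the last coefficient of the split sequence, and the other six types arise by setting some of `b`,
`c`, `e`, `A` to zero. -/
theorem lhs_sub_rhs_of_q (hd : 3 ≤ d) (Φ : LeonardSystem F V d) {i j : ℕ}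
    (hi : 1 ≤ i) (hi' : i ≤ d - 1) (hj : 1 ≤ j) (hj' : j ≤ d - 1) {q : F} (hq : q ≠ 0)
    (a b c e A : F)
    (hth : ∀ k : ℕ, k ≤ d → Φ.th k = Φ.th 0 + (1 - q ^ k) * (c / q ^ k - e * q))
    (hthstar : ∀ k : ℕ, k ≤ d → Φ.thstar k = Φ.thstar 0 + (1 - q ^ k) * (a / q ^ k - b * q))
    (hφ : ∀ k : ℕ, 1 ≤ k → k ≤ d → Φ.firstSplit k = q / (q ^ k) ^ 2 * (1 - q ^ k) *
      (1 - q ^ k / (q * q ^ d)) * (a * c - A * q ^ k + b * e * q * q ^ d * (q ^ k) ^ 2)) :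
    Φ.lhs i j - Φ.rhs i j = Φ.Q i j * ((q - 1) ^ 6 * (q + 1) ^ 2 / (q ^ 3 * q ^ d) *
      (a * b * (c + e * q * q ^ d) ^ 2 - A ^ 2)) := by
  -- Naming q^d, and later q^k, turns the required identities into identities of rational functions
  -- in independent variables.
  obtain ⟨z, hz⟩ : ∃ z, z = q ^ d := ⟨_, rfl⟩
  have hz0 : z ≠ 0 := hz ▸ pow_ne_zero d hq
  have hzd : q ^ (d - 1) = z / q := by
    rw [hz, eq_div_iff hq, ← pow_succ, Nat.sub_add_cancel (by omega)]
  rw [← hz] at hφ ⊢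
  have hφ1 := hφ 1 le_rfl (by omega)
  have hφd := hφ d (by omega) le_rfl
  have ht1 := hthstar 1 (by omega)
  have htd := hthstar d le_rfl
  have htd' := hthstar (d - 1) (by omega)
  have hthd := hth d le_rfl
  rw [← hz] at hφd htd hthd
  rw [hzd] at htd'
  rw [pow_one] at hφ1 ht1
  have hδ0 : Φ.thstar 0 - Φ.thstar 1 = (q - 1) * (a / q - b * q) := by
    rw [ht1]; ring
  have hδd : Φ.thstar (d - 1) - Φ.thstar d = (q - 1) * (a / z - b * z) := by
    rw [htd', htd]; field_simp; ring
  have hTd : Φ.thstar d - Φ.thstar 0 = (1 - z) * (a / z - b * q) := by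
    rw [htd]; ring
  have hΘd : Φ.th d - Φ.th 0 = (1 - z) * (c / z - e * q) := by
    rw [hthd]; ring
  have hφd' : Φ.firstSplit d = q / z ^ 2 * (1 - z) * (1 - 1 / q) *
      (a * c - A * z + b * e * q * z ^ 3) := by
    rw [hφd]; field_simp
  have hback : ∀ k, 1 ≤ k → k + 1 ≤ d →
      Φ.thstar (k - 1) - Φ.thstar k = (q - 1) * (a / q ^ k - b * q ^ k) := by
    intro k hk hk'
    have e1 := hthstar (k - 1) (by omega)
    rw [e1, hthstar k (by omega)]
    obtain ⟨m, rfl⟩ := Nat.exists_eq_add_of_le' hk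
    rw [Nat.add_sub_cancel]
    have := pow_ne_zero m hq
    rw [pow_succ]
    field_simp; ring
  have hforw : ∀ k, 1 ≤ k → k + 1 ≤ d →
      Φ.thstar k - Φ.thstar (k + 1) = (q - 1) * (a / (q * q ^ k) - b * q * q ^ k) := by
    intro k hk hk'
    rw [hthstar k (by omega), hthstar (k + 1) (by omega)]
    have := pow_ne_zero k hq
    rw [pow_succ]
    field_simp; ring
  have hT : ∀ k, 1 ≤ k → k + 1 ≤ d →
      Φ.thstar k - Φ.thstar 0 = (1 - q ^ k) * (a / q ^ k - b * q) := by
    intro k hk hk'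
    rw [hthstar k (by omega)]; ring
  -- Put y = a/q^k + b q q^k, so that T_k = y - a - bq. Then D_k = (q-1)²(y² - ab(q+1)²)/q, and
  -- expanding in T_k gives d₀, d₁, d₂. The constant n₀ is forced by the condition at T = 0, namely
  -- n₀ = φ_1 d₀/(θ*_0 - θ*_1).
  refine Φ.lhs_sub_rhs_of_quadratic hd hi hi' hj hj'
    ((1 - q) * (1 - 1 / z) * (a * c - A * q + b * e * q ^ 3 * z) * (q - 1) * (a - b) / q)
    ((q - 1) ^ 2 * (b * c + a * e + b * e * q * z + a * c / (q * z) + (1 + 1 / (q * z)) * A) -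
      2 * (a + b * q) * (c + e * q) * (q - 1) ^ 2 / q)
    (-(c + e * q) * (q - 1) ^ 2 / q)
    ((q - 1) ^ 2 * (a - b) * (a / q - b * q)) (2 * (a + b * q) * (q - 1) ^ 2 / q)
    ((q - 1) ^ 2 / q) _
    ((1 - z) * (c / z - e * q) * ((q - 1) * (a / z - b * z)) - q / z ^ 2 * (1 - z) * (1 - 1 / q) *
      (a * c - A * z + b * e * q * z ^ 3)) ?_ ?_ ?_ ?_ ?_ ?_
  · intro k hk hk'
    rw [hback k hk hk', hforw k hk hk', hT k hk hk']
    have := pow_ne_zero k hq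
    generalize q ^ k = x at *
    field_simp; ring
  · intro k hk hk'
    rw [hback k hk hk', hforw k hk hk', hT k hk hk', hφ k hk (by omega), hφ (k + 1) (by omega) hk',
      hth k (by omega), pow_succ q k]
    have := pow_ne_zero k hq
    generalize q ^ k = x at *
    field_simp; ring
  · rw [hδ0, hφ1]; field_simp
  · rw [hΘd, hδd, hφd']
  · rw [hTd, hδd]; field_simp; ring
  · rw [hTd, hδd, hδ0, hφ1]; field_simp; ring

end LeonardSystem

/-! ### The types without q: Racah family, Bannai/Ito, orphan -/

namespace LeonardSystem

variable {F : Type u} {V : Type v} [Field F] [AddCommGroup V] [Module F V] {d : ℕ}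

/-- Racah is the general case, `hA` being its relation between r₁ + r₂ and s + s*. Hahn has c = 0,
dual Hahn a = 0, Krawtchouk both. -/
theorem lhs_sub_rhs_of_polynomial (hd : 3 ≤ d) (Φ : LeonardSystem F V d) {i j : ℕ}
    (hi : 1 ≤ i) (hi' : i ≤ d - 1) (hj : 1 ≤ j) (hj' : j ≤ d - 1)
    (a b c e A B : F) (hA : A = a * e + b * c + a * c * (d + 1))
    (hth : ∀ k : ℕ, k ≤ d → Φ.th k = Φ.th 0 + k * (c * (k + 1) + e))
    (hthstar : ∀ k : ℕ, k ≤ d → Φ.thstar k = Φ.thstar 0 + k * (a * (k + 1) + b))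
    (hφ : ∀ k : ℕ, 1 ≤ k → k ≤ d → Φ.firstSplit k =
      k * ((k : F) - d - 1) * (a * c * k ^ 2 + A * k + B)) :
    Φ.lhs i j - Φ.rhs i j = Φ.Q i j *
      (4 * (c ^ 2 * b ^ 2 - 2 * b * c * A + 4 * a * c * B)) := by
  have hcast : ((d - 1 : ℕ) : F) = d - 1 := by
    rw [Nat.cast_sub (by omega), Nat.cast_one]
  have hφ1 := hφ 1 le_rfl (by omega)
  have hφd := hφ d (by omega) le_rfl
  have ht1 := hthstar 1 (by omega)
  have htd := hthstar d le_rfl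
  have htd' := hthstar (d - 1) (by omega)
  have hthd := hth d le_rfl
  rw [hcast] at htd'
  rw [Nat.cast_one] at ht1 hφ1
  have hback : ∀ k, 1 ≤ k → k + 1 ≤ d →
      Φ.thstar (k - 1) - Φ.thstar k = -(2 * a * k + b) := by
    intro k hk hk'
    rw [hthstar (k - 1) (by omega), hthstar k (by omega), Nat.cast_sub hk, Nat.cast_one]
    ring
  have hforw : ∀ k, 1 ≤ k → k + 1 ≤ d →
      Φ.thstar k - Φ.thstar (k + 1) = -(2 * a * (k + 1) + b) := by
    intro k hk hk'
    rw [hthstar k (by omega), hthstar (k + 1) (by omega), Nat.cast_add, Nat.cast_one]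
    ring
  -- Here D_k = (2ak + b)(2a(k+1) + b) = 4aT_k + b(b + 2a), so D is affine.
  refine Φ.lhs_sub_rhs_of_quadratic hd hi hi' hj hj'
    (d * (a * c + A + B) * b)
    (b * e - 2 * (a * c + a * e + b * c) - 2 * B + 2 * (d + 1) * A) (-2 * c)
    (b * (b + 2 * a)) (4 * a) 0 _ _ ?_ ?_ ?_ rfl ?_ ?_
  · intro k hk hk'
    rw [hback k hk hk', hforw k hk hk', hthstar k (by omega)]
    ring
  · intro k hk hk'
    rw [hback k hk hk', hforw k hk hk', hthstar k (by omega), hφ k hk (by omega),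
      hφ (k + 1) (by omega) hk', hth k (by omega), hA, Nat.cast_add, Nat.cast_one]
    ring
  · rw [ht1, hφ1]; ring
  · rw [htd, htd', hφd, hthd, hA]; ring
  · rw [htd, htd', hφd, hthd, ht1, hφ1, hA]; ring

/-- Although θ*_k depends on the parity of k, the same N and D serve both parities. Only the split
sequence, hence N, depends on the parity of d, which also accounts for the sign. -/
theorem lhs_sub_rhs_of_isBannaiIto (hd : 3 ≤ d) (Φ : LeonardSystem F V d) {i j : ℕ}
    (hi : 1 ≤ i) (hi' : i ≤ d - 1) (hj : 1 ≤ j) (hj' : j ≤ d - 1)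
    (h hstar s sstar r₁ r₂ : F) (H : Φ.IsBannaiIto h hstar s sstar r₁ r₂) :
    Φ.lhs i j - Φ.rhs i j = Φ.Q i j *
        (64 * (-1) ^ (d + 1) * h ^ 2 * hstar ^ 2 * (sstar + 2 * r₁) * (sstar + 2 * r₂)) := by
  have hs : s = -sstar + d + 1 - r₁ - r₂ := by linear_combination H.r_add
  have hth0 : ∀ k : ℕ, Even k → k ≤ d → Φ.th k = Φ.th 0 + 2 * h * k := by
    intro k hk hk'
    rw [H.th_eq k hk', hk.neg_one_pow]; ring
  have hth1 : ∀ k : ℕ, Odd k → k ≤ d → Φ.th k = Φ.th 0 + 2 * h * (s - 1 - k) := by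
    intro k hk hk'
    rw [H.th_eq k hk', hk.neg_one_pow]; ring
  have ht0 : ∀ k : ℕ, Even k → k ≤ d → Φ.thstar k = Φ.thstar 0 + 2 * hstar * k := by
    intro k hk hk'
    rw [H.thstar_eq k hk', hk.neg_one_pow]; ring
  have ht1 : ∀ k : ℕ, Odd k → k ≤ d →
      Φ.thstar k = Φ.thstar 0 + 2 * hstar * (sstar - 1 - k) := by
    intro k hk hk'
    rw [H.thstar_eq k hk', hk.neg_one_pow]; ring
  have hb0 : ∀ k : ℕ, Even k → 1 ≤ k → k ≤ d →
      Φ.thstar (k - 1) - Φ.thstar k = 2 * hstar * (sstar - 2 * k) := by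
    intro k hk h1 hk'
    rw [ht0 k hk hk', ht1 (k - 1) (Nat.Even.sub_odd h1 hk odd_one) (by omega), Nat.cast_sub h1,
      Nat.cast_one]
    ring
  have hb1 : ∀ k : ℕ, Odd k → 1 ≤ k → k ≤ d →
      Φ.thstar (k - 1) - Φ.thstar k = 2 * hstar * (2 * k - sstar) := by
    intro k hk h1 hk'
    rw [ht1 k hk hk', ht0 (k - 1) (Nat.Odd.sub_odd hk odd_one) (by omega), Nat.cast_sub h1,
      Nat.cast_one]
    ring
  have hf0 : ∀ k : ℕ, Even k → k + 1 ≤ d →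
      Φ.thstar k - Φ.thstar (k + 1) = 2 * hstar * (2 * k + 2 - sstar) := by
    intro k hk hk'
    have := hb1 (k + 1) hk.add_one (by omega) hk'
    rw [Nat.add_sub_cancel] at this
    rw [this, Nat.cast_add, Nat.cast_one]
    ring
  have hf1 : ∀ k : ℕ, Odd k → k + 1 ≤ d →
      Φ.thstar k - Φ.thstar (k + 1) = 2 * hstar * (sstar - 2 * k - 2) := by
    intro k hk hk'
    have := hb0 (k + 1) hk.add_one (by omega) hk'
    rw [Nat.add_sub_cancel] at this
    rw [this, Nat.cast_add, Nat.cast_one]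
    ring
  have hδ0 : Φ.thstar 0 - Φ.thstar 1 = 2 * hstar * (2 - sstar) := by
    have := hf0 0 Even.zero (by omega)
    rw [this, Nat.cast_zero]
    ring
  -- The quadratic is -4(T - h*s*)(T - h*(s* - 2)). Changing the parity of k interchanges the roles
  -- of its two factors.
  have hD : ∀ k, 1 ≤ k → k + 1 ≤ d →
      (Φ.thstar (k - 1) - Φ.thstar k) * (Φ.thstar k - Φ.thstar (k + 1)) =
        -4 * hstar * sstar * (hstar * sstar - 2 * hstar) +
        8 * hstar * (sstar - 1) * (Φ.thstar k - Φ.thstar 0) +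
        (-4) * (Φ.thstar k - Φ.thstar 0) ^ 2 := by
    intro k hk hk'
    rcases Nat.even_or_odd k with hp | hp
    · rw [hb0 k hp hk (by omega), hf0 k hp hk', ht0 k hp (by omega)]; ring
    · rw [hb1 k hp hk (by omega), hf1 k hp hk', ht1 k hp (by omega)]; ring
  rcases Nat.even_or_odd d with hdp | hdp
  · have hφ0 : ∀ k : ℕ, Even k → 1 ≤ k → k ≤ d →
        Φ.firstSplit k = -4 * h * hstar * k * (k + r₁) :=
      fun k hk h1 h2 => (H.firstSplit_eq k h1 h2).1 hk hdp
    have hφ1 : ∀ k : ℕ, Odd k → 1 ≤ k → k ≤ d →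
        Φ.firstSplit k = -4 * h * hstar * ((k : F) - d - 1) * (k + r₂) :=
      fun k hk h1 h2 => (H.firstSplit_eq k h1 h2).2.1 hk hdp
    have hφ1' := hφ1 1 odd_one le_rfl (by omega)
    rw [Nat.cast_one] at hφ1'
    refine Φ.lhs_sub_rhs_of_quadratic hd hi hi' hj hj'
      (8 * hstar ^ 2 * h * sstar * d * (1 + r₂))
      (4 * hstar * h * (2 * r₁ + sstar * s - 2 * d - 2 * d * r₂)) (4 * h * (1 - s))
      _ _ _ _ _ hD ?_ ?_ rfl ?_ ?_
    · intro k hk hk'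
      rcases Nat.even_or_odd k with hp | hp
      · rw [hb0 k hp hk (by omega), hf0 k hp hk', ht0 k hp (by omega), hφ0 k hp hk (by omega),
          hφ1 (k + 1) hp.add_one (by omega) hk', hth0 k hp (by omega), hs, Nat.cast_add,
          Nat.cast_one]
        ring
      · rw [hb1 k hp hk (by omega), hf1 k hp hk', ht1 k hp (by omega), hφ1 k hp hk (by omega),
          hφ0 (k + 1) hp.add_one (by omega) hk', hth1 k hp (by omega), hs, Nat.cast_add,
          Nat.cast_one]
        ring
    · rw [hδ0, hφ1']; ring
    · rw [hb0 d hdp (by omega) le_rfl, ht0 d hdp le_rfl, hth0 d hdp le_rfl,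
        hφ0 d hdp (by omega) le_rfl, hs]
      ring
    · rw [hb0 d hdp (by omega) le_rfl, ht0 d hdp le_rfl, hth0 d hdp le_rfl,
        hφ0 d hdp (by omega) le_rfl, hδ0, hφ1', hdp.add_one.neg_one_pow, hs]
      ring
  · have hφ0 : ∀ k : ℕ, Even k → 1 ≤ k → k ≤ d →
        Φ.firstSplit k = -4 * h * hstar * k * ((k : F) - d - 1) :=
      fun k hk h1 h2 => (H.firstSplit_eq k h1 h2).2.2.1 hk hdp
    have hφ1 : ∀ k : ℕ, Odd k → 1 ≤ k → k ≤ d →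
        Φ.firstSplit k = -4 * h * hstar * (k + r₁) * (k + r₂) :=
      fun k hk h1 h2 => (H.firstSplit_eq k h1 h2).2.2.2 hk hdp
    have hφ1' := hφ1 1 odd_one le_rfl (by omega)
    rw [Nat.cast_one] at hφ1'
    refine Φ.lhs_sub_rhs_of_quadratic hd hi hi' hj hj'
      (-8 * hstar ^ 2 * h * sstar * (1 + r₁) * (1 + r₂))
      (4 * hstar * h * (2 - 2 * s - 2 * sstar + 2 * r₁ * r₂ + sstar * s)) (4 * h * (1 - s))
      _ _ _ _ _ hD ?_ ?_ rfl ?_ ?_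
    · intro k hk hk'
      rcases Nat.even_or_odd k with hp | hp
      · rw [hb0 k hp hk (by omega), hf0 k hp hk', ht0 k hp (by omega), hφ0 k hp hk (by omega),
          hφ1 (k + 1) hp.add_one (by omega) hk', hth0 k hp (by omega), hs, Nat.cast_add,
          Nat.cast_one]
        ring
      · rw [hb1 k hp hk (by omega), hf1 k hp hk', ht1 k hp (by omega), hφ1 k hp hk (by omega),
          hφ0 (k + 1) hp.add_one (by omega) hk', hth1 k hp (by omega), hs, Nat.cast_add,
          Nat.cast_one]
        ring
    · rw [hδ0, hφ1']; ring
    · rw [hb1 d hdp (by omega) le_rfl, ht1 d hdp le_rfl, hth1 d hdp le_rfl,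
        hφ1 d hdp (by omega) le_rfl, hs]
      ring
    · rw [hb1 d hdp (by omega) le_rfl, ht1 d hdp le_rfl, hth1 d hdp le_rfl,
        hφ1 d hdp (by omega) le_rfl, hδ0, hφ1', hdp.add_one.neg_one_pow, hs]
      ring

/-- The orphan type: here `a_k (θ*_{k-1} - θ*_k)(θ*_k - θ*_{k+1})` is an affine function of `θ*_k`
since `k` takes two values only. -/
theorem lhs_sub_rhs_of_isOrphan (hd : 3 ≤ d) (Φ : LeonardSystem F V d) {i j : ℕ}
    (hi : 1 ≤ i) (hi' : i ≤ d - 1) (hj : 1 ≤ j) (hj' : j ≤ d - 1)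
    (h hstar s sstar r : F) (H : Φ.IsOrphan h hstar s sstar r) :
    Φ.lhs i j - Φ.rhs i j = Φ.Q i j * (h ^ 2 * hstar ^ 2 * (sstar ^ 2 + 1)) := by
  have h2 : (2 : F) = 0 := by
    have := ringChar.Nat.cast_ringChar (R := F)
    rw [H.char_eq] at this
    exact_mod_cast this
  have : CharP F 2 := CharP.congr (ringChar F) H.char_eq
  obtain rfl := H.d_eq
  obtain ⟨ht1, ht2, ht3⟩ := H.thstar_eq
  obtain ⟨hth1, hth2, hth3⟩ := H.th_eq
  obtain ⟨hφ1, hφ2, hφ3⟩ := H.firstSplit_eq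
  -- D_1 and D_2 coincide in characteristic 2, so D can be taken constant. The condition at T = 0
  -- then gives n₀, the values at k = 1, 2 give n₁ and n₂, and the condition at T = T_3 is satisfied
  -- as well.
  refine Φ.lhs_sub_rhs_of_quadratic hd hi hi' hj hj' (h * hstar ^ 2 * r * sstar)
    (h * hstar * s * sstar) h (hstar ^ 2 * sstar * (sstar + 1)) 0 0 _ _ ?_ ?_ ?_ rfl ?_ ?_
  · intro k hk hk'
    obtain rfl | rfl : k = 1 ∨ k = 2 := by omega
    all_goals
      norm_num only
      rw [ht1, ht2]
      try rw [ht3]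
      grind
  · intro k hk hk'
    obtain rfl | rfl : k = 1 ∨ k = 2 := by omega
    · norm_num only
      rw [ht1, ht2, hth1, hφ1, hφ2]
      grind
    · norm_num only
      rw [ht1, ht2, ht3, hth2, hφ2, hφ3]
      grind
  · rw [ht1, hφ1]
    grind
  · norm_num only
    rw [ht2, ht3, hφ3, hth3]
    grind
  · norm_num only
    rw [ht1, ht2, ht3, hφ3, hth3, hφ1]
    grind

end LeonardSystem

/-! ### Integer powers of q, and specialization to the individual types -/

theorem zpow_neg_three_sub {F : Type*} [Field F] (q : F) (d : ℕ) :
    q ^ (-3 - (d : ℤ)) = (q ^ 3 * q ^ d)⁻¹ := by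
  rw [show -3 - (d : ℤ) = -((3 + d : ℕ) : ℤ) by push_cast; ring, zpow_neg, zpow_natCast, pow_add]

theorem zpow_one_sub_cast {F : Type*} [Field F] {q : F} (hq : q ≠ 0) (k : ℕ) :
    q ^ (1 - (k : ℤ)) = q / q ^ k := by
  rw [zpow_sub₀ hq, zpow_one, zpow_natCast]

theorem zpow_one_sub_two_mul {F : Type*} [Field F] {q : F} (hq : q ≠ 0) (k : ℕ) :
    q ^ (1 - 2 * (k : ℤ)) = q / (q ^ k) ^ 2 := by
  rw [zpow_sub₀ hq, zpow_one, mul_comm, zpow_mul, zpow_natCast]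
  norm_cast

theorem zpow_sub_sub_one {F : Type*} [Field F] {q : F} (hq : q ≠ 0) (k d : ℕ) :
    q ^ ((k : ℤ) - d - 1) = q ^ k / (q * q ^ d) := by
  rw [zpow_sub₀ hq, zpow_sub₀ hq, zpow_one, zpow_natCast, zpow_natCast, div_div, mul_comm]

theorem proposition8p1 {F : Type u} {V : Type v} [Field F] [IsAlgClosed F] [AddCommGroup V]
    [Module F V] {d : ℕ} (hd : 3 ≤ d) (Φ : LeonardSystem F V d)
    (i j : ℕ) (hi : 1 ≤ i) (hi' : i ≤ d - 1) (hj : 1 ≤ j) (hj' : j ≤ d - 1) :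
    (∀ q h hstar s sstar r₁ r₂ : F, Φ.IsQRacah q h hstar s sstar r₁ r₂ →
      Φ.lhs i j - Φ.rhs i j = Φ.Q i j *
        (h ^ 2 * hstar ^ 2 * q ^ (-3 - (d : ℤ)) * (q - 1) ^ 4 * (q ^ 2 - 1) ^ 2 *
          (sstar - r₁ ^ 2) * (sstar - r₂ ^ 2) / sstar)) ∧
    (∀ q h hstar sstar r : F, Φ.IsQHahn q h hstar sstar r →
      Φ.lhs i j - Φ.rhs i j = Φ.Q i j *
        (h ^ 2 * hstar ^ 2 * q ^ (-3 - (d : ℤ)) * (q - 1) ^ 4 * (q ^ 2 - 1) ^ 2 *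
          (sstar - r ^ 2))) ∧
    (∀ q h hstar s r : F, Φ.IsDualQHahn q h hstar s r →
      Φ.lhs i j - Φ.rhs i j = Φ.Q i j *
        (-(h ^ 2 * hstar ^ 2 * q ^ (-3 - (d : ℤ)) * (q - 1) ^ 4 * (q ^ 2 - 1) ^ 2 * r ^ 2))) ∧
    (∀ q hstar s r : F, Φ.IsQuantumQKrawtchouk q hstar s r →
      Φ.lhs i j - Φ.rhs i j = Φ.Q i j *
        (-(hstar ^ 2 * q ^ (-3 - (d : ℤ)) * (q - 1) ^ 4 * (q ^ 2 - 1) ^ 2 * r ^ 2))) ∧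
    (∀ q h hstar sstar : F, Φ.IsQKrawtchouk q h hstar sstar →
      Φ.lhs i j - Φ.rhs i j = Φ.Q i j *
        (h ^ 2 * hstar ^ 2 * q ^ (-3 - (d : ℤ)) * (q - 1) ^ 4 * (q ^ 2 - 1) ^ 2 * sstar)) ∧
    (∀ q h hstar r : F, Φ.IsAffineQKrawtchouk q h hstar r →
      Φ.lhs i j - Φ.rhs i j = Φ.Q i j *
        (-(h ^ 2 * hstar ^ 2 * q ^ (-3 - (d : ℤ)) * (q - 1) ^ 4 * (q ^ 2 - 1) ^ 2 * r ^ 2))) ∧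
    (∀ q h hstar s : F, Φ.IsDualQKrawtchouk q h hstar s →
      Φ.lhs i j - Φ.rhs i j = Φ.Q i j * 0) ∧
    (∀ h hstar s sstar r₁ r₂ : F, Φ.IsRacah h hstar s sstar r₁ r₂ →
      Φ.lhs i j - Φ.rhs i j = Φ.Q i j *
        (4 * h ^ 2 * hstar ^ 2 * (sstar - 2 * r₁) * (sstar - 2 * r₂))) ∧
    (∀ hstar s sstar r : F, Φ.IsHahn hstar s sstar r →
      Φ.lhs i j - Φ.rhs i j = Φ.Q i j * 0) ∧
    (∀ h s sstar r : F, Φ.IsDualHahn h s sstar r →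
      Φ.lhs i j - Φ.rhs i j = Φ.Q i j * (-4 * h ^ 2 * sstar ^ 2)) ∧
    (∀ s sstar r : F, Φ.IsKrawtchouk s sstar r →
      Φ.lhs i j - Φ.rhs i j = Φ.Q i j * 0) ∧
    (∀ h hstar s sstar r₁ r₂ : F, Φ.IsBannaiIto h hstar s sstar r₁ r₂ →
      Φ.lhs i j - Φ.rhs i j = Φ.Q i j *
        (64 * (-1) ^ (d + 1) * h ^ 2 * hstar ^ 2 * (sstar + 2 * r₁) * (sstar + 2 * r₂))) ∧
    (∀ h hstar s sstar r : F, Φ.IsOrphan h hstar s sstar r →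
      Φ.lhs i j - Φ.rhs i j = Φ.Q i j * (h ^ 2 * hstar ^ 2 * (sstar ^ 2 + 1))) := by

  refine ⟨?_, ?_, ?_, ?_, ?_, ?_, ?_, ?_, ?_, ?_, ?_,
    Φ.lhs_sub_rhs_of_isBannaiIto hd hi hi' hj hj', Φ.lhs_sub_rhs_of_isOrphan hd hi hi' hj hj'⟩
  · intro q h hstar s sstar r₁ r₂ H
    obtain ⟨hq, -, -, -, hs, -, -⟩ := H.ne_zero
    rw [Φ.lhs_sub_rhs_of_q hd hi hi' hj hj' hq hstar (hstar * sstar) h (h * s)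
      (h * hstar * (r₁ + r₂))]
    · have hr := H.r_mul
      rw [pow_succ] at hr
      have hqd := pow_ne_zero d hq
      rw [zpow_neg_three_sub q]
      generalize q ^ d = z at *
      -- Modulo r₁r₂ = s s* q^{d+1}, the product depends on r₁, r₂ only through their sum, as in the
      -- common formula.
      have e : (sstar - r₁ ^ 2) * (sstar - r₂ ^ 2) =
          sstar * (sstar * (1 + s * q * z) ^ 2 - (r₁ + r₂) ^ 2) := by
        linear_combination (r₁ * r₂ + s * sstar * z * q + 2 * sstar) * hr
      rw [mul_assoc _ (sstar - r₁ ^ 2), e]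
      field_simp
      ring
    · intro k hk
      rw [H.th_eq k hk, zpow_neg, zpow_natCast]
      have := pow_ne_zero k hq
      field_simp
      ring
    · intro k hk
      rw [H.thstar_eq k hk, zpow_neg, zpow_natCast]
      have := pow_ne_zero k hq
      field_simp
      ring
    · intro k hk hk'
      rw [H.firstSplit_eq k hk hk', zpow_one_sub_two_mul hq, zpow_sub_sub_one hq]
      have := pow_ne_zero k hq
      have := pow_ne_zero d hq
      have hr := H.r_mul
      rw [pow_succ] at hr
      linear_combination h * hstar * (q / (q ^ k) ^ 2 * (1 - q ^ k) *
        (1 - q ^ k / (q * q ^ d))) * (q ^ k) ^ 2 * hr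
  · intro q h hstar sstar r H
    obtain ⟨hq, -⟩ := H.ne_zero
    rw [Φ.lhs_sub_rhs_of_q hd hi hi' hj hj' hq hstar (hstar * sstar) h 0 (h * hstar * r)]
    · have hqd := pow_ne_zero d hq
      rw [zpow_neg_three_sub q]
      field_simp
      ring
    · intro k hk
      rw [H.th_eq k hk, zpow_neg, zpow_natCast]
      ring
    · intro k hk
      rw [H.thstar_eq k hk, zpow_neg, zpow_natCast]
      have := pow_ne_zero k hq
      field_simp
      ring
    · intro k hk hk'
      rw [H.firstSplit_eq k hk hk', zpow_one_sub_two_mul hq, zpow_sub_sub_one hq]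
      ring
  · intro q h hstar s r H
    obtain ⟨hq, -⟩ := H.ne_zero
    rw [Φ.lhs_sub_rhs_of_q hd hi hi' hj hj' hq hstar 0 h (h * s) (h * hstar * r)]
    · have hqd := pow_ne_zero d hq
      rw [zpow_neg_three_sub q]
      field_simp
      ring
    · intro k hk
      rw [H.th_eq k hk, zpow_neg, zpow_natCast]
      have := pow_ne_zero k hq
      field_simp
      ring
    · intro k hk
      rw [H.thstar_eq k hk, zpow_neg, zpow_natCast]
      ring
    · intro k hk hk'
      rw [H.firstSplit_eq k hk hk', zpow_one_sub_two_mul hq, zpow_sub_sub_one hq]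
      ring
  · intro q hstar s r H
    obtain ⟨hq, -⟩ := H.ne_zero
    -- The eigenvalues θ_k contain no q^{-k} term, so here c = 0 and e = s.
    rw [Φ.lhs_sub_rhs_of_q hd hi hi' hj hj' hq hstar 0 0 s (hstar * r)]
    · have hqd := pow_ne_zero d hq
      rw [zpow_neg_three_sub q]
      field_simp
      ring
    · intro k hk
      rw [H.th_eq k hk]
      ring
    · intro k hk
      rw [H.thstar_eq k hk, zpow_neg, zpow_natCast]
      ring
    · intro k hk hk'
      rw [H.firstSplit_eq k hk hk', zpow_one_sub_cast hq, zpow_sub_sub_one hq]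
      have := pow_ne_zero k hq
      have := pow_ne_zero d hq
      field_simp
      ring
  · intro q h hstar sstar H
    obtain ⟨hq, -⟩ := H.ne_zero
    rw [Φ.lhs_sub_rhs_of_q hd hi hi' hj hj' hq hstar (hstar * sstar) h 0 0]
    · have hqd := pow_ne_zero d hq
      rw [zpow_neg_three_sub q]
      field_simp
      ring
    · intro k hk
      rw [H.th_eq k hk, zpow_neg, zpow_natCast]
      ring
    · intro k hk
      rw [H.thstar_eq k hk, zpow_neg, zpow_natCast]
      have := pow_ne_zero k hq
      field_simp
      ring
    · intro k hk hk'
      rw [H.firstSplit_eq k hk hk', zpow_one_sub_two_mul hq, zpow_sub_sub_one hq]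
      ring
  · intro q h hstar r H
    obtain ⟨hq, -⟩ := H.ne_zero
    rw [Φ.lhs_sub_rhs_of_q hd hi hi' hj hj' hq hstar 0 h 0 (h * hstar * r)]
    · have hqd := pow_ne_zero d hq
      rw [zpow_neg_three_sub q]
      field_simp
      ring
    · intro k hk
      rw [H.th_eq k hk, zpow_neg, zpow_natCast]
      ring
    · intro k hk
      rw [H.thstar_eq k hk, zpow_neg, zpow_natCast]
      ring
    · intro k hk hk'
      rw [H.firstSplit_eq k hk hk', zpow_one_sub_two_mul hq, zpow_sub_sub_one hq]
      ring
  · intro q h hstar s H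
    obtain ⟨hq, -⟩ := H.ne_zero
    rw [Φ.lhs_sub_rhs_of_q hd hi hi' hj hj' hq hstar 0 h (h * s) 0]
    · ring
    · intro k hk
      rw [H.th_eq k hk, zpow_neg, zpow_natCast]
      have := pow_ne_zero k hq
      field_simp
      ring
    · intro k hk
      rw [H.thstar_eq k hk, zpow_neg, zpow_natCast]
      ring
    · intro k hk hk'
      rw [H.firstSplit_eq k hk hk', zpow_one_sub_two_mul hq, zpow_sub_sub_one hq]
      ring
  · intro h hstar s sstar r₁ r₂ H
    rw [Φ.lhs_sub_rhs_of_polynomial hd hi hi' hj hj' hstar (hstar * sstar) h (h * s)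
      (h * hstar * (r₁ + r₂)) (h * hstar * (r₁ * r₂)) (by rw [H.r_add]; ring)]
    · ring
    · intro k hk
      rw [H.th_eq k hk]; ring
    · intro k hk
      rw [H.thstar_eq k hk]; ring
    · intro k hk hk'
      rw [H.firstSplit_eq k hk hk']; ring
  · intro hstar s sstar r H
    rw [Φ.lhs_sub_rhs_of_polynomial hd hi hi' hj hj' hstar (hstar * sstar) 0 s
      (hstar * s) (hstar * s * r) (by ring)]
    · ring
    · intro k hk
      rw [H.th_eq k hk]; ring
    · intro k hk
      rw [H.thstar_eq k hk]; ring
    · intro k hk hk'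
      rw [H.firstSplit_eq k hk hk']; ring
  · intro h s sstar r H
    rw [Φ.lhs_sub_rhs_of_polynomial hd hi hi' hj hj' 0 sstar h (h * s)
      (h * sstar) (h * sstar * r) (by ring)]
    · ring
    · intro k hk
      rw [H.th_eq k hk]; ring
    · intro k hk
      rw [H.thstar_eq k hk]; ring
    · intro k hk hk'
      rw [H.firstSplit_eq k hk hk']; ring
  · intro s sstar r H
    rw [Φ.lhs_sub_rhs_of_polynomial hd hi hi' hj hj' 0 sstar 0 s 0 r (by ring)]
    · ring
    · intro k hk
      rw [H.th_eq k hk]; ring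
    · intro k hk
      rw [H.thstar_eq k hk]; ring
    · intro k hk hk'
      rw [H.firstSplit_eq k hk hk']; ring
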